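/- A \emph{moon polyomino} is a finite set $M$ of boxes $(r,c)$ (row $r$, column $c$, $r,c\ge 1$, matrix coordinates) that is convex (if two boxes of $M$ lie in the same row or column, all boxes in between are in $M$) and intersection-free (for any two columns, the set of rows occupied by one is contained in that of the other). Let $k\ge 1$. A \emph{north-east chain} of length $\ell$ in $M$ is a sequence of $\ell$ boxes of $M$, each strictly north and strictly east of the preceding one, such that the smallest rectangle containing all of them is contained in $M$. A $(0,1)$-filling of $M$ is identified with its set of boxes filled with $1$. A \emph{$k$-north-east filling} of $M$ is a $(0,1)$-filling of $M$ without north-east chains of $1$'s of length $k+1$ whose number of $1$'s is maximal among such fillings. For a permutation $\sigma$ of $\{1,2,\dots\}$ fixing all but finitely many points, let $\ell(\sigma)$ be the minimal number of simple transpositions whose product is $\sigma$, let $D(\sigma)=\{(i,\sigma_j): i<j,\ \sigma_i>\sigma_j\}$, and let $r_\sigma(p,q)=\#\{i\le p:\sigma_i\le q\}$. The \emph{essential set} of $\sigma$ is the set of boxes $(p,q)\in D(\sigma)$ with $(p+1,q),(p,q+1)\notin D(\sigma)$, each labelled by $r_\sigma(p,q)$. Let $\sigma_k(M)$ be the permutation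 whose essential set consists of the boxes $(i+b,j+a)$ labelled by $a+b+k$, one for each inclusion-maximal rectangle contained in $M$ of width and height both larger than $k$, where $(a+1,b+1)$ and $(i,j)$ are the north-west and south-east corner boxes of the rectangle. Then $\sigma_k(M)$ is well defined, i.e. there is exactly one such permutation; every filling of $M$ that is inclusion-maximal among those without north-east chains of $1$'s of length $k+1$ is a $k$-north-east filling; and every $k$-north-east filling of $M$ has exactly $|M|-\ell(\sigma_k(M))$ filled boxes. If $M$ is a Ferrers shape (a set of boxes that contains with $(r,c)$ all $(r',c')$ with $1\le r'\le r$, $1\le c'\le c$), this number equals the number of boxes of $M$ that lie in the first $k$ rows or in the first $k$ columns. -/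

import Mathlib

/-!
Boxes are pairs `(row, column) : ℕ × ℕ`, rows counted from north to south and columns from west to
east. Both are counted from `0`, and so are the positions and values of permutations, so that the
box `(r, c)` here is the box `(r + 1, c + 1)` in the usual matrix coordinates.
A `(0,1)`-filling of a set of boxes is identified with the set of boxes that are filled with a `1`.
-/

namespace MoonFilling

/-- Any two boxes in the same row, or in the same column, have all boxes in between in `M`. -/
def IsConvex (M : Finset (ℕ × ℕ)) : Prop :=
  (∀ r c₁ c c₂ : ℕ, (r, c₁) ∈ M → (r, c₂) ∈ M → c₁ ≤ c → c ≤ c₂ → (r, c) ∈ M) ∧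
  (∀ c r₁ r r₂ : ℕ, (r₁, c) ∈ M → (r₂, c) ∈ M → r₁ ≤ r → r ≤ r₂ → (r, c) ∈ M)

/-- For any two columns of `M`, one is contained in the other (as sets of rows). -/
def IsIntersectionFree (M : Finset (ℕ × ℕ)) : Prop :=
  ∀ c₁ c₂ : ℕ, (∀ r, (r, c₁) ∈ M → (r, c₂) ∈ M) ∨ (∀ r, (r, c₂) ∈ M → (r, c₁) ∈ M)

def IsMoonPolyomino (M : Finset (ℕ × ℕ)) : Prop :=
  IsConvex M ∧ IsIntersectionFree M

/-- A Ferrers shape (north-west justified): with a box, all boxes weakly north-west of it. -/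
def IsFerrersShape (M : Finset (ℕ × ℕ)) : Prop :=
  IsLowerSet (M : Set (ℕ × ℕ))

/-- The smallest rectangle that contains all boxes of the sequence `c`. -/
def smallestRectangle {l : ℕ} (c : Fin l → ℕ × ℕ) : Set (ℕ × ℕ) :=
  {p | ((∃ x, (c x).1 ≤ p.1) ∧ (∃ x, p.1 ≤ (c x).1)) ∧
       ((∃ x, (c x).2 ≤ p.2) ∧ (∃ x, p.2 ≤ (c x).2))}

/-- `c` is a north-east chain of length `l` in `M`: a sequence of boxes of `M`, each strictly north
and strictly east of the preceding ones, whose smallest enclosing rectangle is contained in `M`. -/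
def IsNEChain (M : Finset (ℕ × ℕ)) {l : ℕ} (c : Fin l → ℕ × ℕ) : Prop :=
  (∀ x, c x ∈ M) ∧
  (∀ x y, x < y → (c y).1 < (c x).1 ∧ (c x).2 < (c y).2) ∧
  smallestRectangle c ⊆ (M : Set (ℕ × ℕ))

/-- `F` is a `(0,1)`-filling of `M` without a north-east chain (in `M`) of `1`s of length `k + 1`. -/
def IsNEFree (k : ℕ) (M F : Finset (ℕ × ℕ)) : Prop :=
  F ⊆ M ∧ ¬ ∃ c : Fin (k + 1) → ℕ × ℕ, IsNEChain M c ∧ ∀ x, c x ∈ F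

/-- `F` is a `k`-north-east filling of `M`: it has no north-east chain of `1`s of length `k + 1`,
and its number of `1`s is maximal among such fillings. -/
def IsNEFilling (k : ℕ) (M F : Finset (ℕ × ℕ)) : Prop :=
  IsNEFree k M F ∧ ∀ G, IsNEFree k M G → G.card ≤ F.card

/-- The rectangle with north-west corner box `(a, b)` and south-east corner box `(i, j)` is nonempty,
is contained in `M`, and is contained in no larger rectangle inside `M`. -/
def IsMaximalRectangle (M : Finset (ℕ × ℕ)) (a b i j : ℕ) : Prop :=
  a ≤ i ∧ b ≤ j ∧ Finset.Icc (a, b) (i, j) ⊆ M ∧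
  ∀ a' b' i' j' : ℕ, Finset.Icc (a', b') (i', j') ⊆ M →
    Finset.Icc (a, b) (i, j) ⊆ Finset.Icc (a', b') (i', j') →
    Finset.Icc (a', b') (i', j') = Finset.Icc (a, b) (i, j)

/-- The boxes `(i + b, j + a)` marked with `a + b + k`, one for each maximal rectangle in `M` of
height and width larger than `k`, where `(a, b)` and `(i, j)` are its north-west and south-east
corner boxes. (In coordinates counted from `1` the north-west corner is `(a + 1, b + 1)`, and the
formulas for the marked box and for its label are the same.) -/
def markedBoxes (k : ℕ) (M : Finset (ℕ × ℕ)) : Set ((ℕ × ℕ) × ℕ) :=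
  {x | ∃ a b i j : ℕ, IsMaximalRectangle M a b i j ∧ k < i + 1 - a ∧ k < j + 1 - b ∧
    x = ((i + b, j + a), a + b + k)}

/-- The Rothe diagram `{(i, σ j) : i < j, σ i > σ j}`. -/
def rotheDiagram (σ : Equiv.Perm ℕ) : Set (ℕ × ℕ) :=
  {x | ∃ i j : ℕ, i < j ∧ σ j < σ i ∧ x = (i, σ j)}

/-- The number of `i` weakly north of `p` such that `σ i` is weakly west of `q`. -/
def rankFun (σ : Equiv.Perm ℕ) (p q : ℕ) : ℕ :=
  ((Finset.range (p + 1)).filter (fun i => σ i ≤ q)).card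

/-- The essential set: the south-east corner boxes `(p, q)` of the diagram, with their labels. -/
def essentialSet (σ : Equiv.Perm ℕ) : Set ((ℕ × ℕ) × ℕ) :=
  {x | ∃ p q : ℕ, (p, q) ∈ rotheDiagram σ ∧ (p + 1, q) ∉ rotheDiagram σ ∧
    (p, q + 1) ∉ rotheDiagram σ ∧ x = ((p, q), rankFun σ p q)}

/-- `σ` moves only finitely many points, i.e. it lies in one of the nested symmetric groups. -/
def IsFinitary (σ : Equiv.Perm ℕ) : Prop :=
  ∃ n : ℕ, ∀ i, n ≤ i → σ i = i

/-- `σ` is the permutation `σ_k(M)`: its labelled essential set is the set of marked boxes. -/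
def IsSigma (k : ℕ) (M : Finset (ℕ × ℕ)) (σ : Equiv.Perm ℕ) : Prop :=
  IsFinitary σ ∧ essentialSet σ = markedBoxes k M

/-- The minimal number of simple transpositions needed to write the (finitary) permutation `σ`. -/
noncomputable def length (σ : Equiv.Perm ℕ) : ℕ :=
  sInf {m | ∃ w : List ℕ, w.length = m ∧ (w.map (fun i => Equiv.swap i (i + 1))).prod = σ}

end MoonFilling

/-!
The boxes of `M` are read row by row from north to south, each row from east to west, and the box
`(r, c)` stands for the simple transposition of `r + c` and `r + c + 1`. With this reading, a
filling `F` has no north-east chain of length `k + 1` if and only if the word of the empty boxes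
`M \ F` contains a reduced word of `σ_k(M)`. The maximal fillings are then the complements of
reduced words of `σ_k(M)`, so they all have `|M| - ℓ(σ_k(M))` boxes. The proof carries this out with
rank functions only and never forms the words.

* For a set `D` of boxes let `antiRank D p q` be the size of the longest antidiagonal (the set of
  boxes of a chain) in the first `p` rows and `q` columns that avoids `D`. Removing the last box
  `(r, c)` of `D` changes `antiRank D p q` for `p = r + c + 1` only, and there the change is bounded
  by that of a Demazure operator (`antiRank_erase_of_ne`, `antiRank_diag`). Induction along the
  reading order, with a case distinction on whether `σ` has an ascent or a descent at `r + c`, gives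
  the subword property `exists_subset_card_eq_inv`: if `antiRank D ≤ rk σ`, then some `E ⊆ D` with
  exactly as many boxes as `σ` has inversions also satisfies `antiRank E ≤ rk σ`.
* By `le_rk_of_le_essentialSet` it suffices to test `antiRank D ≤ rk σ` on the essential set. For
  `σ = σ_k(M)` and `D = M \ F`, the test in a marked box says that `F` has no chain of length
  `k + 1` in the corresponding maximal rectangle (`isNEFree_iff`), because `M` has no boxes in the corner
  regions of a maximal rectangle.
* The permutation `σ_k(M)` is unique since a permutation is determined by its essential set. For the
  existence let `sigmaRank k M` be the pointwise largest function that satisfies the conditions in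
  the marked boxes and grows like a rank function. Maximal rectangles cross each other
  (`IsMaximalRectangle.nested`), so the marked boxes lie on a path from north-east to south-west;
  therefore this function is supermodular, hence the rank function of a permutation
  (`exists_perm_rk_eq`), and its essential boxes can be read off.
* For a Ferrers shape, one maximal filling is explicit (`IsFerrersShape.maximal_filter`).
-/

namespace MoonFilling

/-! ### Rank functions of permutations -/

/-- The number of `i < p` with `σ i < q`: the rank function, with rows and columns counted. -/
def rk (σ : Equiv.Perm ℕ) (p q : ℕ) : ℕ :=
  ((Finset.range p).filter (fun i => σ i < q)).card

lemma rankFun_eq_rk (σ : Equiv.Perm ℕ) (p q : ℕ) : rankFun σ p q = rk σ (p + 1) (q + 1) := by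
  simp [rankFun, rk]

@[simp] lemma rk_zero_left (σ : Equiv.Perm ℕ) (q : ℕ) : rk σ 0 q = 0 := by simp [rk]

@[simp] lemma rk_zero_right (σ : Equiv.Perm ℕ) (p : ℕ) : rk σ p 0 = 0 := by simp [rk]

lemma rk_succ_left (σ : Equiv.Perm ℕ) (p q : ℕ) :
    rk σ (p + 1) q = rk σ p q + if σ p < q then 1 else 0 := by
  rw [rk, Finset.range_add_one, Finset.filter_insert]
  split_ifs with h
  · rw [Finset.card_insert_of_notMem (by simp), rk]
  · rw [rk, add_zero]

lemma rk_succ_right (σ : Equiv.Perm ℕ) (p q : ℕ) :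
    rk σ p (q + 1) = rk σ p q + if σ.symm q < p then 1 else 0 := by
  induction p with
  | zero => simp
  | succ p ih =>
    have key : σ p = q ↔ σ.symm q = p := by rw [Equiv.symm_apply_eq, eq_comm]
    rw [rk_succ_left, rk_succ_left, ih]
    split_ifs <;> omega

lemma eq_of_rk_eq {σ τ : Equiv.Perm ℕ} (h : ∀ p q, rk σ p q = rk τ p q) : σ = τ := by
  have key : ∀ p q, σ p < q ↔ τ p < q := by
    intro p q
    have h₁ := h (p + 1) q
    rw [rk_succ_left, rk_succ_left, h p q] at h₁
    split_ifs at h₁ <;> omega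
  ext p
  have h₁ := key p (σ p + 1)
  have h₂ := key p (τ p)
  have h₃ := key p (σ p)
  omega

/-- An integer function on `ℕ × ℕ` that grows like a rank function: it vanishes on the axes and
each of its increments is `0` or `1`. -/
structure IsRankLike (K : ℕ → ℕ → ℕ) : Prop where
  zero_left : ∀ q, K 0 q = 0
  zero_right : ∀ p, K p 0 = 0
  le_succ_left : ∀ p q, K p q ≤ K (p + 1) q
  succ_left_le : ∀ p q, K (p + 1) q ≤ K p q + 1
  le_succ_right : ∀ p q, K p q ≤ K p (q + 1)
  succ_right_le : ∀ p q, K p (q + 1) ≤ K p q + 1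

lemma isRankLike_rk (σ : Equiv.Perm ℕ) : IsRankLike (rk σ) where
  zero_left := rk_zero_left σ
  zero_right := rk_zero_right σ
  le_succ_left p q := by rw [rk_succ_left]; omega
  succ_left_le p q := by rw [rk_succ_left]; split_ifs <;> omega
  le_succ_right p q := by rw [rk_succ_right]; omega
  succ_right_le p q := by rw [rk_succ_right]; split_ifs <;> omega

/-! ### The essential set -/

lemma mem_rotheDiagram {σ : Equiv.Perm ℕ} {p q : ℕ} :
    (p, q) ∈ rotheDiagram σ ↔ q < σ p ∧ p < σ.symm q := by
  constructor
  · rintro ⟨i, j, hij, hσ, h⟩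
    obtain ⟨rfl, rfl⟩ := Prod.mk.inj h
    simpa using ⟨hσ, hij⟩
  · rintro ⟨h₁, h₂⟩
    exact ⟨p, σ.symm q, h₂, by simpa using h₁, by simp⟩

/-- An essential box is one at which the rank function is constant to the north and to the west, and
increases to the south and to the east. -/
lemma mem_essentialSet {σ : Equiv.Perm ℕ} {x : (ℕ × ℕ) × ℕ} :
    x ∈ essentialSet σ ↔ ∃ p q : ℕ, x = ((p, q), rk σ (p + 1) (q + 1)) ∧
      rk σ p (q + 1) = rk σ (p + 1) (q + 1) ∧ rk σ (p + 1) q = rk σ (p + 1) (q + 1) ∧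
      rk σ (p + 2) (q + 1) = rk σ (p + 1) (q + 1) + 1 ∧
      rk σ (p + 1) (q + 2) = rk σ (p + 1) (q + 1) + 1 := by
  have key : ∀ p q, σ p = q ↔ σ.symm q = p := by
    intro p q
    rw [Equiv.symm_apply_eq, eq_comm]
  simp only [essentialSet, Set.mem_ofPred_eq, mem_rotheDiagram, rankFun_eq_rk]
  refine exists_congr fun p => exists_congr fun q => ?_
  rw [rk_succ_left σ (p + 1) (q + 1), rk_succ_right σ (p + 1) (q + 1)]
  have h₁ := rk_succ_left σ p (q + 1)
  have h₂ := rk_succ_right σ (p + 1) q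
  have k₁ := key (p + 1) q
  have k₂ := key p (q + 1)
  constructor
  · rintro ⟨⟨a, b⟩, c, d, e⟩
    refine ⟨e, ?_⟩
    split_ifs at h₁ h₂ ⊢ <;> omega
  · rintro ⟨e, f⟩
    refine ⟨?_, ?_, ?_, e⟩ <;> split_ifs at h₁ h₂ f <;> omega

/-- Rank conditions on the essential set imply all rank conditions. In the diagram one can move
south or east without changing the rank until an essential box is reached; outside the diagram
the rank drops by one when moving north, or when moving west. -/
lemma le_rk_of_le_essentialSet {σ : Equiv.Perm ℕ} (hσ : IsFinitary σ) {K : ℕ → ℕ → ℕ}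
    (hK : IsRankLike K)
    (h : ∀ p q l, ((p, q), l) ∈ essentialSet σ → K (p + 1) (q + 1) ≤ l) (p q : ℕ) :
    K p q ≤ rk σ p q := by
  obtain ⟨n, hn⟩ := hσ
  have bound : ∀ p q, (p, q) ∈ rotheDiagram σ → p < n ∧ q < n := by
    intro p q hpq
    rw [mem_rotheDiagram] at hpq
    constructor
    · by_contra hp
      have h₁ := hn p (by omega)
      have h₂ := hn (σ.symm q) (by omega)
      rw [Equiv.apply_symm_apply] at h₂
      omega
    · by_contra hq
      have h₁ := hn q (by omega)
      have h₂ : σ.symm q = q := by rw [Equiv.symm_apply_eq, h₁]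
      have h₃ := hn (σ p) (by omega)
      have := σ.injective h₃
      omega
  have diag : ∀ m p q, 2 * n ≤ m + p + q → (p, q) ∈ rotheDiagram σ →
      K (p + 1) (q + 1) ≤ rk σ (p + 1) (q + 1) := by
    intro m
    induction m with
    | zero =>
      intro p q hm hpq
      have := bound p q hpq
      omega
    | succ m ih =>
      intro p q hm hpq
      by_cases h₁ : (p + 1, q) ∈ rotheDiagram σ
      · have h₂ := ih (p + 1) q (by omega) h₁
        rw [rk_succ_left, if_neg (by rw [mem_rotheDiagram] at h₁; omega)] at h₂
        exact (hK.le_succ_left _ _).trans h₂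
      by_cases h₁' : (p, q + 1) ∈ rotheDiagram σ
      · have h₂ := ih p (q + 1) (by omega) h₁'
        rw [rk_succ_right, if_neg (by rw [mem_rotheDiagram] at h₁'; omega)] at h₂
        exact (hK.le_succ_right _ _).trans h₂
      exact h p q _ ⟨p, q, hpq, h₁, h₁', by rw [rankFun_eq_rk]⟩
  induction p generalizing q with
  | zero => simp [hK.zero_left]
  | succ p ihp =>
    induction q with
    | zero => simp [hK.zero_right]
    | succ q ihq =>
      by_cases hpq : (p, q) ∈ rotheDiagram σ
      · exact diag _ p q (Nat.le_add_right_of_le (Nat.le_add_right _ _)) hpq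
      · rw [mem_rotheDiagram] at hpq
        by_cases h₁ : σ p < q + 1
        · rw [rk_succ_left, if_pos h₁]
          have := ihp (q + 1)
          have := hK.succ_left_le p (q + 1)
          omega
        · rw [rk_succ_right, if_pos (by omega)]
          have := hK.succ_right_le (p + 1) q
          omega

lemma eq_of_essentialSet_eq {σ τ : Equiv.Perm ℕ} (hσ : IsFinitary σ) (hτ : IsFinitary τ)
    (h : essentialSet σ = essentialSet τ) : σ = τ := by
  have key : ∀ {σ τ : Equiv.Perm ℕ}, IsFinitary τ → essentialSet σ = essentialSet τ →
      ∀ p q, rk σ p q ≤ rk τ p q := by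
    intro σ τ hτ h
    refine le_rk_of_le_essentialSet hτ (isRankLike_rk σ) fun p q l hl => ?_
    rw [← h] at hl
    obtain ⟨p', q', -, -, -, e⟩ := hl
    simp only [Prod.mk.injEq, rankFun_eq_rk] at e
    obtain ⟨⟨rfl, rfl⟩, rfl⟩ := e
    exact le_rfl
  exact eq_of_rk_eq fun p q => le_antisymm (key hτ h p q) (key hσ h.symm p q)

/-! ### Permutations with a given rank function -/

/-- A supermodular rank-like function that agrees with `min` far out is the rank function of a
permutation: its mixed second differences form the permutation matrix. -/
lemma exists_perm_rk_eq {R : ℕ → ℕ → ℕ} (hR : IsRankLike R)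
    (hmod : ∀ p q, R p (q + 1) + R (p + 1) q ≤ R (p + 1) (q + 1) + R p q)
    (N : ℕ) (hN : ∀ p q, N ≤ p ∨ N ≤ q → R p q = min p q) :
    ∃ σ : Equiv.Perm ℕ, IsFinitary σ ∧ ∀ p q, rk σ p q = R p q := by
  have exL : ∀ p, ∃ q, R (p + 1) (q + 1) = R p (q + 1) + 1 := fun p =>
    ⟨p + N, by rw [hN _ _ (by omega), hN _ _ (by omega)]; omega⟩
  have exR : ∀ q, ∃ p, R (p + 1) (q + 1) = R (p + 1) q + 1 := fun q =>
    ⟨q + N, by rw [hN _ _ (by omega), hN _ _ (by omega)]; omega⟩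
  have monoL : ∀ p q m, R (p + 1) q = R p q + 1 → R (p + 1) (q + m) = R p (q + m) + 1 := by
    intro p q m hq
    induction m with
    | zero => exact hq
    | succ m ih =>
      have := hmod p (q + m)
      have := hR.succ_left_le p (q + m + 1)
      rw [← add_assoc]
      omega
  have monoR : ∀ q p m, R p (q + 1) = R p q + 1 → R (p + m) (q + 1) = R (p + m) q + 1 := by
    intro q p m hq
    induction m with
    | zero => exact hq
    | succ m ih =>
      have := hmod (p + m) q
      have := hR.succ_right_le (p + m + 1) q
      rw [← add_assoc]
      omega
  classical
  let f : ℕ → ℕ := fun p => Nat.find (exL p)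
  let g : ℕ → ℕ := fun q => Nat.find (exR q)
  have f_lt : ∀ p q, f p < q ↔ R (p + 1) q = R p q + 1 := by
    intro p q
    constructor
    · intro h
      obtain ⟨m, rfl⟩ := Nat.exists_eq_add_of_le (Nat.succ_le_of_lt h)
      exact monoL p _ m (Nat.find_spec (exL p))
    · intro h
      cases q with
      | zero => rw [hR.zero_right, hR.zero_right] at h; omega
      | succ q => exact Nat.lt_succ_of_le (Nat.find_min' (exL p) h)
  have g_lt : ∀ q p, g q < p ↔ R p (q + 1) = R p q + 1 := by
    intro q p
    constructor
    · intro h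
      obtain ⟨m, rfl⟩ := Nat.exists_eq_add_of_le (Nat.succ_le_of_lt h)
      exact monoR q _ m (Nat.find_spec (exR q))
    · intro h
      cases p with
      | zero => rw [hR.zero_left, hR.zero_left] at h; omega
      | succ p => exact Nat.lt_succ_of_le (Nat.find_min' (exR q) h)
  have fg : ∀ p q, f p = q ↔ g q = p := by
    intro p q
    have h₁ := f_lt p q
    have h₂ := f_lt p (q + 1)
    have h₃ := g_lt q p
    have h₄ := g_lt q (p + 1)
    have := hmod p q
    have := hR.le_succ_left p q
    have := hR.le_succ_left p (q + 1)
    have := hR.le_succ_right p q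
    have := hR.le_succ_right (p + 1) q
    have := hR.succ_left_le p q
    have := hR.succ_left_le p (q + 1)
    have := hR.succ_right_le p q
    have := hR.succ_right_le (p + 1) q
    omega
  refine ⟨⟨f, g, fun p => (fg p _).1 rfl, fun q => (fg _ q).2 rfl⟩, ⟨N, fun p hp => ?_⟩, ?_⟩
  · change f p = p
    have h₁ := f_lt p p
    have h₂ := f_lt p (p + 1)
    rw [hN _ _ (by omega), hN _ _ (by omega)] at h₁ h₂
    omega
  · intro p q
    induction p with
    | zero => simp [hR.zero_left]
    | succ p ih =>
      rw [rk_succ_left, ih]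
      change R p q + (if f p < q then 1 else 0) = _
      have := f_lt p q
      have := hR.le_succ_left p q
      have := hR.succ_left_le p q
      split_ifs <;> omega

/-! ### Inversions and length -/

/-- The pairs of positions whose values are in the wrong order. -/
def inversions (σ : Equiv.Perm ℕ) : Set (ℕ × ℕ) :=
  {x | x.1 < x.2 ∧ σ x.2 < σ x.1}

/-- The number of inversions; it is `0` by convention if there are infinitely many. -/
noncomputable def inv (σ : Equiv.Perm ℕ) : ℕ := (inversions σ).ncard

lemma IsFinitary.finite_inversions {σ : Equiv.Perm ℕ} (hσ : IsFinitary σ) :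
    (inversions σ).Finite := by
  obtain ⟨n, hn⟩ := hσ
  refine ((Set.finite_Iio n).prod (Set.finite_Iio n)).subset ?_
  rintro ⟨a, b⟩ ⟨h₁, h₂⟩
  have hb : b < n := by
    by_contra hb
    have hb' := hn b (by omega)
    have := σ.injective (hn (σ a) (by simp only at h₁ h₂; omega))
    simp only at h₁ h₂
    omega
  exact ⟨lt_trans h₁ hb, hb⟩

lemma IsFinitary.mul_swap {σ : Equiv.Perm ℕ} (hσ : IsFinitary σ) (i : ℕ) :
    IsFinitary (σ * Equiv.swap i (i + 1)) := by
  obtain ⟨n, hn⟩ := hσ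
  refine ⟨n + i + 2, fun j hj => ?_⟩
  rw [Equiv.Perm.mul_apply, Equiv.swap_apply_of_ne_of_ne (by omega) (by omega), hn j (by omega)]

lemma inv_one : inv 1 = 0 := by
  have : inversions 1 = ∅ := by
    ext x
    simp only [inversions, Equiv.Perm.one_apply, Set.mem_ofPred_eq, Set.mem_empty_iff_false,
      iff_false, not_and, not_lt]
    exact le_of_lt
  rw [inv, this, Set.ncard_empty]

lemma swap_succ_apply (i j : ℕ) : Equiv.swap i (i + 1) j =
    if j = i then i + 1 else if j = i + 1 then i else j := by
  rw [Equiv.swap_apply_def]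

lemma inv_mul_swap {σ : Equiv.Perm ℕ} (hσ : IsFinitary σ) {i : ℕ} (hi : σ i < σ (i + 1)) :
    inv (σ * Equiv.swap i (i + 1)) = inv σ + 1 := by
  set s := Equiv.swap i (i + 1) with hs
  have hss : ∀ j, s (s j) = j := fun j => Equiv.swap_apply_self _ _ j
  have hmono : ∀ a b, a < b → ¬ (a = i ∧ b = i + 1) → s a < s b := by
    intro a b hab hne
    rw [hs, swap_succ_apply, swap_succ_apply]
    split_ifs <;> omega
  have hset : inversions (σ * s) = insert (i, i + 1) (Prod.map s s '' inversions σ) := by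
    ext ⟨a, b⟩
    simp only [inversions, Equiv.Perm.mul_apply, Set.mem_ofPred_eq, Set.mem_insert_iff,
      Prod.mk.injEq, Set.mem_image, Prod.exists, Prod.map_apply]
    constructor
    · rintro ⟨h₁, h₂⟩
      by_cases hab : a = i ∧ b = i + 1
      · exact Or.inl hab
      · exact Or.inr ⟨s a, s b, ⟨hmono a b h₁ hab, h₂⟩, hss a, hss b⟩
    · rintro (⟨rfl, rfl⟩ | ⟨a', b', ⟨h₁, h₂⟩, rfl, rfl⟩)
      · simpa [hs] using hi
      · rw [hss, hss]
        refine ⟨hmono _ _ h₁ ?_, h₂⟩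
        rintro ⟨rfl, rfl⟩
        omega
  have hinj : Function.Injective (Prod.map s s) := s.injective.prodMap s.injective
  rw [inv, hset, Set.ncard_insert_of_notMem _ (hσ.finite_inversions.image _),
    Set.ncard_image_of_injective _ hinj, inv]
  rintro ⟨⟨a, b⟩, ⟨h₁, -⟩, h₃⟩
  simp only [Prod.map_apply, Prod.mk.injEq] at h₁ h₃
  obtain ⟨h₃, h₄⟩ := h₃
  rw [hs, swap_succ_apply] at h₃ h₄
  split_ifs at h₃ h₄ <;> omega

lemma mul_swap_mul_swap (σ : Equiv.Perm ℕ) (i : ℕ) :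
    σ * Equiv.swap i (i + 1) * Equiv.swap i (i + 1) = σ := by
  rw [mul_assoc, Equiv.swap_mul_self, mul_one]

lemma inv_eq_of_descent {σ : Equiv.Perm ℕ} (hσ : IsFinitary σ) {i : ℕ} (hi : σ (i + 1) < σ i) :
    inv σ = inv (σ * Equiv.swap i (i + 1)) + 1 := by
  conv_lhs => rw [← mul_swap_mul_swap σ i]
  exact inv_mul_swap (hσ.mul_swap i) (by simpa using hi)

lemma ne_apply_succ (σ : Equiv.Perm ℕ) (i : ℕ) : σ i ≠ σ (i + 1) := fun h => by
  have := σ.injective h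
  omega

lemma eq_one_of_forall_lt {σ : Equiv.Perm ℕ} (h : ∀ i, σ i < σ (i + 1)) : σ = 1 := by
  have hmono : StrictMono σ := strictMono_nat_of_lt_succ h
  have hsymm : StrictMono σ.symm := fun a b hab => by
    rw [← hmono.lt_iff_lt]; simpa using hab
  ext j
  exact le_antisymm (by simpa using hsymm.le_apply (x := σ j)) hmono.le_apply

/-- The minimal number of simple transpositions in a factorization is the number of inversions. -/
lemma length_eq_inv {σ : Equiv.Perm ℕ} (hσ : IsFinitary σ) : length σ = inv σ := by
  have lower : ∀ w : List ℕ, IsFinitary (w.map fun i => Equiv.swap i (i + 1)).prod ∧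
      inv (w.map fun i => Equiv.swap i (i + 1)).prod ≤ w.length := by
    intro w
    induction w using List.reverseRecOn with
    | nil => exact ⟨⟨0, fun i _ => rfl⟩, by simp [inv_one]⟩
    | append_singleton w i ih =>
      obtain ⟨hf, hle⟩ := ih
      simp only [List.map_append, List.map_cons, List.map_nil, List.prod_append, List.prod_cons,
        List.prod_nil, mul_one, List.length_append, List.length_cons, List.length_nil]
      refine ⟨hf.mul_swap i, ?_⟩
      rcases lt_or_gt_of_ne (ne_apply_succ _ i) with h | h
      · rw [inv_mul_swap hf h]
        omega
      · have := inv_eq_of_descent hf h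
        omega
  have upper : ∀ n, ∀ τ : Equiv.Perm ℕ, IsFinitary τ → inv τ = n →
      ∃ w : List ℕ, w.length = n ∧ (w.map fun i => Equiv.swap i (i + 1)).prod = τ := by
    intro n
    induction n with
    | zero =>
      intro τ hτ h
      refine ⟨[], rfl, ?_⟩
      rw [eq_one_of_forall_lt (σ := τ)]
      · rfl
      · intro i
        by_contra hi
        have := inv_eq_of_descent hτ (lt_of_le_of_ne (not_lt.1 hi) (ne_apply_succ τ i).symm)
        omega
    | succ n ih =>
      intro τ hτ h
      obtain ⟨i, hi⟩ : ∃ i, τ (i + 1) < τ i := by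
        by_contra! hne
        have h1 := eq_one_of_forall_lt fun i => lt_of_le_of_ne (hne i) (ne_apply_succ τ i)
        rw [h1, inv_one] at h
        omega
      have hinv := inv_eq_of_descent hτ hi
      obtain ⟨w, hw, hprod⟩ := ih _ (hτ.mul_swap i) (by omega)
      refine ⟨w ++ [i], by simp [hw], ?_⟩
      simp only [List.map_append, List.map_cons, List.map_nil, List.prod_append, List.prod_cons,
        List.prod_nil, mul_one, hprod, mul_swap_mul_swap]
  refine le_antisymm (Nat.sInf_le (upper _ σ hσ rfl)) ?_
  refine le_csInf ⟨_, upper _ σ hσ rfl⟩ ?_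
  rintro m ⟨w, rfl, rfl⟩
  exact (lower w).2

/-! ### Rank functions and simple transpositions -/

lemma rk_mul_swap (σ : Equiv.Perm ℕ) (i : ℕ) {p : ℕ} (hp : p ≠ i + 1) (q : ℕ) :
    rk (σ * Equiv.swap i (i + 1)) p q = rk σ p q := by
  have low : ∀ m ≤ i, rk (σ * Equiv.swap i (i + 1)) m q = rk σ m q := by
    intro m hm
    induction m with
    | zero => simp
    | succ m ih =>
      rw [rk_succ_left, rk_succ_left, ih (by omega), Equiv.Perm.mul_apply,
        Equiv.swap_apply_of_ne_of_ne (by omega) (by omega)]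
  have high : ∀ m, rk (σ * Equiv.swap i (i + 1)) (i + 2 + m) q = rk σ (i + 2 + m) q := by
    intro m
    induction m with
    | zero =>
      rw [add_zero, rk_succ_left, rk_succ_left, rk_succ_left σ, rk_succ_left σ, low i le_rfl]
      simp only [Equiv.Perm.mul_apply, Equiv.swap_apply_left, Equiv.swap_apply_right]
      omega
    | succ m ih =>
      rw [← add_assoc, rk_succ_left, rk_succ_left, ih, Equiv.Perm.mul_apply,
        Equiv.swap_apply_of_ne_of_ne (by omega) (by omega)]
  rcases Nat.lt_or_ge i p with h | h
  · obtain ⟨m, rfl⟩ := Nat.exists_eq_add_of_le (show i + 2 ≤ p by omega)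
    exact high m
  · exact low p h

/-- At an ascent `i` the row `i + 1` of the rank function is as large as its neighbours allow. -/
lemma le_rk_of_ascent {τ : Equiv.Perm ℕ} {i : ℕ} (hi : τ i < τ (i + 1)) {K : ℕ → ℕ → ℕ}
    (hK : IsRankLike K) (h : ∀ p q, p ≠ i + 1 → K p q ≤ rk τ p q) (p q : ℕ) :
    K p q ≤ rk τ p q := by
  by_cases hp : p = i + 1
  · subst hp
    have h₁ := h i q (by omega)
    have h₂ := h (i + 2) q (by omega)
    have h₃ := hK.succ_left_le i q
    have h₄ := hK.le_succ_left (i + 1) q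
    have h₅ := rk_succ_left τ i q
    have h₆ := rk_succ_left τ (i + 1) q
    split_ifs at h₅ h₆ <;> simp only [add_assoc, Nat.reduceAdd] at * <;> omega
  · exact h p q hp

/-! ### Antidiagonals -/

/-- A finite set of boxes of which any two different ones are strictly north-east and south-west
of each other: the set of boxes of a north-east chain. -/
def IsAntidiag (Z : Finset (ℕ × ℕ)) : Prop :=
  ∀ x ∈ Z, ∀ y ∈ Z, x ≠ y → (x.1 < y.1 ∧ y.2 < x.2) ∨ (y.1 < x.1 ∧ x.2 < y.2)

lemma IsAntidiag.subset {Z Y : Finset (ℕ × ℕ)} (hZ : IsAntidiag Z) (h : Y ⊆ Z) : IsAntidiag Y :=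
  fun x hx y hy => hZ x (h hx) y (h hy)

lemma IsAntidiag.fst_injOn {Z : Finset (ℕ × ℕ)} (hZ : IsAntidiag Z) :
    (Z : Set (ℕ × ℕ)).InjOn Prod.fst := by
  intro x hx y hy h
  by_contra hne
  have := hZ x hx y hy hne
  omega

lemma IsAntidiag.snd_injOn {Z : Finset (ℕ × ℕ)} (hZ : IsAntidiag Z) :
    (Z : Set (ℕ × ℕ)).InjOn Prod.snd := by
  intro x hx y hy h
  by_contra hne
  have := hZ x hx y hy hne
  omega

lemma IsAntidiag.card_le_of_fst {Z : Finset (ℕ × ℕ)} (hZ : IsAntidiag Z) {a n : ℕ}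
    (h : ∀ x ∈ Z, a ≤ x.1 ∧ x.1 < a + n) : Z.card ≤ n := by
  have := Finset.card_le_card_of_injOn (t := Finset.Ico a (a + n)) Prod.fst
    (fun x hx => by simpa using h x hx) hZ.fst_injOn
  simpa using this

lemma IsAntidiag.card_le_of_snd {Z : Finset (ℕ × ℕ)} (hZ : IsAntidiag Z) {a n : ℕ}
    (h : ∀ x ∈ Z, a ≤ x.2 ∧ x.2 < a + n) : Z.card ≤ n := by
  have := Finset.card_le_card_of_injOn (t := Finset.Ico a (a + n)) Prod.snd
    (fun x hx => by simpa using h x hx) hZ.snd_injOn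
  simpa using this

/-- The boxes in the rows from `a` on and those in the first `n` columns are both initial segments
of an antidiagonal, so one of the two sets contains the other. -/
lemma IsAntidiag.card_filter_southwest_le {Z : Finset (ℕ × ℕ)} (hZ : IsAntidiag Z) {a n : ℕ}
    (h : ∀ x ∈ Z, x.1 < a + n) : (Z.filter fun x => a ≤ x.1 ∨ x.2 < n).card ≤ n := by
  have hsub := hZ.subset (Finset.filter_subset (fun x => a ≤ x.1 ∨ x.2 < n) Z)
  by_cases hu : ∃ u ∈ Z, a ≤ u.1 ∧ n ≤ u.2
  · obtain ⟨u, hu, h₁, h₂⟩ := hu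
    refine hsub.card_le_of_fst (a := a) fun x hx => ?_
    rw [Finset.mem_filter] at hx
    refine ⟨?_, h x hx.1⟩
    by_cases hxu : x = u
    · rw [hxu]; exact h₁
    · have := hZ x hx.1 u hu hxu
      omega
  · push Not at hu
    refine hsub.card_le_of_snd (a := 0) fun x hx => ?_
    rw [Finset.mem_filter] at hx
    have := hu x hx.1
    omega

lemma IsAntidiag.card_filter_northeast_le {Z : Finset (ℕ × ℕ)} (hZ : IsAntidiag Z) {a n : ℕ}
    (h : ∀ x ∈ Z, x.2 < a + n) : (Z.filter fun x => a ≤ x.2 ∨ x.1 < n).card ≤ n := by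
  have hsub := hZ.subset (Finset.filter_subset (fun x => a ≤ x.2 ∨ x.1 < n) Z)
  by_cases hu : ∃ u ∈ Z, a ≤ u.2 ∧ n ≤ u.1
  · obtain ⟨u, hu, h₁, h₂⟩ := hu
    refine hsub.card_le_of_snd (a := a) fun x hx => ?_
    rw [Finset.mem_filter] at hx
    refine ⟨?_, h x hx.1⟩
    by_cases hxu : x = u
    · rw [hxu]; exact h₁
    · have := hZ x hx.1 u hu hxu
      omega
  · push Not at hu
    refine hsub.card_le_of_fst (a := 0) fun x hx => ?_
    rw [Finset.mem_filter] at hx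
    have := hu x hx.1
    omega

/-- If all boxes of `A` are strictly south-west of all boxes of `B`, the antidiagonals `A` and `B`
combine. -/
lemma IsAntidiag.union {A B : Finset (ℕ × ℕ)} (hA : IsAntidiag A) (hB : IsAntidiag B)
    (h : ∀ x ∈ A, ∀ y ∈ B, y.1 < x.1 ∧ x.2 < y.2) :
    IsAntidiag (A ∪ B) ∧ (A ∪ B).card = A.card + B.card := by
  constructor
  · intro x hx y hy hne
    rw [Finset.mem_union] at hx hy
    rcases hx with hx | hx <;> rcases hy with hy | hy
    · exact hA x hx y hy hne
    · exact Or.inr (h x hx y hy)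
    · exact Or.inl (h y hy x hx)
    · exact hB x hx y hy hne
  · refine Finset.card_union_of_disjoint (Finset.disjoint_left.2 fun x hx hx' => ?_)
    have := h x hx x hx'
    omega

/-- The antidiagonal of the square of size `n` with north-west corner box `(a, b)`. -/
def segment (a b n : ℕ) : Finset (ℕ × ℕ) :=
  (Finset.range n).image fun s => (a + (n - 1 - s), b + s)

lemma mem_segment {a b n : ℕ} {x : ℕ × ℕ} :
    x ∈ segment a b n ↔ a ≤ x.1 ∧ b ≤ x.2 ∧ x.1 + x.2 + 1 = a + b + n := by
  obtain ⟨r, c⟩ := x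
  simp only [segment, Finset.mem_image, Finset.mem_range, Prod.mk.injEq]
  constructor
  · rintro ⟨s, hs, rfl, rfl⟩
    omega
  · rintro ⟨h₁, h₂, h₃⟩
    exact ⟨c - b, by omega, by omega, by omega⟩

lemma isAntidiag_segment (a b n : ℕ) : IsAntidiag (segment a b n) := by
  rintro ⟨r, c⟩ hx ⟨r', c'⟩ hy hne
  rw [mem_segment] at hx hy
  rw [Ne, Prod.mk.injEq] at hne
  simp only at *
  omega

lemma card_segment (a b n : ℕ) : (segment a b n).card = n := by
  rw [segment, Finset.card_image_of_injective, Finset.card_range]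
  intro s t h
  simp only [Prod.mk.injEq] at h
  omega

/-! ### The longest antidiagonal that avoids a set of boxes -/

open Classical in
/-- The largest size of an antidiagonal in the first `p` rows and `q` columns that avoids `D`.
As a function of `p` and `q` it is the rank function of the Demazure product of the simple
transpositions with index `r + c` for the boxes `(r, c)` of `D`, in reading order. -/
noncomputable def antiRank (D : Finset (ℕ × ℕ)) (p q : ℕ) : ℕ :=
  (((Finset.range p ×ˢ Finset.range q) \ D).powerset.filter IsAntidiag).sup Finset.card

lemma antiRank_le {D : Finset (ℕ × ℕ)} {p q n : ℕ}
    (h : ∀ Z, IsAntidiag Z → (∀ x ∈ Z, x.1 < p ∧ x.2 < q ∧ x ∉ D) → Z.card ≤ n) :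
    antiRank D p q ≤ n := by
  classical
  refine Finset.sup_le fun Z hZ => ?_
  rw [Finset.mem_filter, Finset.mem_powerset] at hZ
  refine h Z hZ.2 fun x hx => ?_
  have := hZ.1 hx
  simp only [Finset.mem_sdiff, Finset.mem_product, Finset.mem_range] at this
  tauto

lemma le_antiRank {D : Finset (ℕ × ℕ)} {p q : ℕ} {Z : Finset (ℕ × ℕ)} (hZ : IsAntidiag Z)
    (h : ∀ x ∈ Z, x.1 < p ∧ x.2 < q ∧ x ∉ D) : Z.card ≤ antiRank D p q := by
  classical
  refine Finset.le_sup (f := Finset.card) ?_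
  rw [Finset.mem_filter, Finset.mem_powerset]
  refine ⟨fun x hx => ?_, hZ⟩
  have := h x hx
  simp only [Finset.mem_sdiff, Finset.mem_product, Finset.mem_range]
  tauto

lemma antiRank_anti {D E : Finset (ℕ × ℕ)} (h : E ⊆ D) (p q : ℕ) :
    antiRank D p q ≤ antiRank E p q :=
  antiRank_le fun _ hZ hb => le_antiRank hZ fun x hx =>
    ⟨(hb x hx).1, (hb x hx).2.1, fun hE => (hb x hx).2.2 (h hE)⟩

lemma antiRank_mono {D : Finset (ℕ × ℕ)} {p p' q q' : ℕ} (hp : p ≤ p') (hq : q ≤ q') :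
    antiRank D p q ≤ antiRank D p' q' :=
  antiRank_le fun _ hZ hb => le_antiRank hZ fun x hx =>
    ⟨(hb x hx).1.trans_le hp, (hb x hx).2.1.trans_le hq, (hb x hx).2.2⟩

lemma isRankLike_antiRank (D : Finset (ℕ × ℕ)) : IsRankLike (antiRank D) where
  zero_left q := Nat.le_zero.1 <| antiRank_le fun Z _ hb => by
    rw [Finset.eq_empty_of_forall_notMem fun x hx => Nat.not_lt_zero _ (hb x hx).1]
    simp
  zero_right p := Nat.le_zero.1 <| antiRank_le fun Z _ hb => by
    rw [Finset.eq_empty_of_forall_notMem fun x hx => Nat.not_lt_zero _ (hb x hx).2.1]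
    simp
  le_succ_left p q := antiRank_mono (Nat.le_succ p) le_rfl
  le_succ_right p q := antiRank_mono le_rfl (Nat.le_succ q)
  succ_left_le p q := antiRank_le fun Z hZ hb => by
    have h₁ : (Z.filter fun x => x.1 < p).card ≤ antiRank D p q :=
      le_antiRank (hZ.subset (Finset.filter_subset _ _)) fun x hx => by
        rw [Finset.mem_filter] at hx
        exact ⟨hx.2, (hb x hx.1).2⟩
    have h₂ : (Z.filter fun x => ¬ x.1 < p).card ≤ 1 :=
      (hZ.subset (Finset.filter_subset _ _)).card_le_of_fst (a := p) fun x hx => by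
        rw [Finset.mem_filter] at hx
        have := hb x hx.1
        omega
    have := Finset.card_filter_add_card_filter_not (s := Z) fun x => x.1 < p
    omega
  succ_right_le p q := antiRank_le fun Z hZ hb => by
    have h₁ : (Z.filter fun x => x.2 < q).card ≤ antiRank D p q :=
      le_antiRank (hZ.subset (Finset.filter_subset _ _)) fun x hx => by
        rw [Finset.mem_filter] at hx
        exact ⟨(hb x hx.1).1, hx.2, (hb x hx.1).2.2⟩
    have h₂ : (Z.filter fun x => ¬ x.2 < q).card ≤ 1 :=
      (hZ.subset (Finset.filter_subset _ _)).card_le_of_snd (a := q) fun x hx => by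
        rw [Finset.mem_filter] at hx
        have := hb x hx.1
        omega
    have := Finset.card_filter_add_card_filter_not (s := Z) fun x => x.2 < q
    omega

lemma le_antiRank_empty (p : ℕ) : p ≤ antiRank ∅ p p := by
  have := le_antiRank (D := ∅) (p := p) (q := p) (isAntidiag_segment 0 0 p) fun x hx => by
    rw [mem_segment] at hx
    exact ⟨by omega, by omega, by simp⟩
  rwa [card_segment] at this

/-! ### Removing the last box in reading order -/

/-- The box `x` comes last in `D` when the rows are read from north to south, each row from east to
west. -/
def IsLast (D : Finset (ℕ × ℕ)) (x : ℕ × ℕ) : Prop :=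
  x ∈ D ∧ ∀ y ∈ D, y.1 < x.1 ∨ (y.1 = x.1 ∧ x.2 ≤ y.2)

lemma exists_isLast {D : Finset (ℕ × ℕ)} (hD : D.Nonempty) : ∃ x, IsLast D x := by
  obtain ⟨u, hu, hmax⟩ := D.exists_max_image Prod.fst hD
  obtain ⟨x, hx, hmin⟩ := (D.filter fun y => y.1 = u.1).exists_min_image Prod.snd
    ⟨u, by simp [hu]⟩
  rw [Finset.mem_filter] at hx
  refine ⟨x, hx.1, fun y hy => ?_⟩
  by_cases h : y.1 = u.1
  · exact Or.inr ⟨by omega, hmin y (by simp [hy, h])⟩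
  · have := hmax y hy
    exact Or.inl (by omega)

/-- In an antidiagonal, the boxes with `P` may be replaced by a segment with `m` more boxes (or with
even more), if it lies south-west of the remaining boxes. -/
lemma IsAntidiag.card_add_le_antiRank {Z D : Finset (ℕ × ℕ)} (hZ : IsAntidiag Z)
    (P : ℕ × ℕ → Prop) [DecidablePred P] {p q a n m : ℕ}
    (hb : ∀ x ∈ Z, ¬ P x → x.1 < p ∧ x.2 < q ∧ x ∉ D)
    (hrest : ∀ x ∈ Z, ¬ P x → x.1 < a ∧ n ≤ x.2)
    (hseg : ∀ x ∈ segment a 0 n, x.1 < p ∧ x.2 < q ∧ x ∉ D)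
    (hcard : (Z.filter P).card + m ≤ n) : Z.card + m ≤ antiRank D p q := by
  obtain ⟨h₁, h₂⟩ := (isAntidiag_segment a 0 n).union
    (hZ.subset (Finset.filter_subset (fun x => ¬ P x) Z)) (fun x hx y hy => by
      rw [mem_segment] at hx
      rw [Finset.mem_filter] at hy
      have := hrest y hy.1 hy.2
      omega)
  have h₃ := le_antiRank (D := D) (p := p) (q := q) h₁ fun x hx => by
    rcases Finset.mem_union.1 hx with hx | hx
    · exact hseg x hx
    · rw [Finset.mem_filter] at hx
      exact hb x hx.1 hx.2
  rw [h₂, card_segment] at h₃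
  have := Finset.card_filter_add_card_filter_not (s := Z) P
  omega

/-- A box matters only for the rank conditions in the row of its antidiagonal. -/
lemma antiRank_erase_of_ne {D : Finset (ℕ × ℕ)} {x : ℕ × ℕ} (hx : IsLast D x) {p : ℕ}
    (hp : p ≠ x.1 + x.2 + 1) (q : ℕ) : antiRank D p q = antiRank (D.erase x) p q := by
  refine le_antisymm (antiRank_anti (Finset.erase_subset _ _) p q) ?_
  refine antiRank_le fun Z hZ hb => ?_
  have hD : ∀ y ∈ Z, y ≠ x → y ∉ D := fun y hy hne hyD =>
    (hb y hy).2.2 (Finset.mem_erase.2 ⟨hne, hyD⟩)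
  by_cases hxZ : x ∈ Z
  · have hxb := hb x hxZ
    rcases lt_or_gt_of_ne hp with h | h
    · -- the boxes from row `x.1` on give way to the segment in the rows from `x.1` to `p - 1`
      refine hZ.card_add_le_antiRank (fun y => x.1 ≤ y.1) (a := x.1) (n := p - x.1) (m := 0)
        (fun y hy hPy => ⟨(hb y hy).1, (hb y hy).2.1, hD y hy ?_⟩) (fun y hy hPy => ?_)
        (fun y hy => ?_) ?_
      · rintro rfl
        exact hPy le_rfl
      · have := hZ y hy x hxZ (by rintro rfl; exact hPy le_rfl)
        omega
      · rw [mem_segment] at hy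
        refine ⟨by omega, by omega, fun hyD => ?_⟩
        have := hx.2 y hyD
        omega
      · refine (hZ.subset (Finset.filter_subset _ _)).card_le_of_fst (a := x.1) fun y hy => ?_
        rw [Finset.mem_filter] at hy
        have := hb y hy.1
        omega
    · -- the boxes up to column `x.2` give way to the segment in these columns below row `x.1`
      refine hZ.card_add_le_antiRank (fun y => y.2 < x.2 + 1) (a := x.1 + 1) (n := x.2 + 1) (m := 0)
        (fun y hy hPy => ⟨(hb y hy).1, (hb y hy).2.1, hD y hy ?_⟩) (fun y hy hPy => ?_)
        (fun y hy => ?_) ?_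
      · rintro rfl
        exact hPy (Nat.lt_succ_self _)
      · have := hZ y hy x hxZ (by rintro rfl; exact hPy (Nat.lt_succ_self _))
        omega
      · rw [mem_segment] at hy
        refine ⟨by omega, by omega, fun hyD => ?_⟩
        have := hx.2 y hyD
        omega
      · refine (hZ.subset (Finset.filter_subset _ _)).card_le_of_snd (a := 0) fun y hy => ?_
        rw [Finset.mem_filter] at hy
        omega
  · exact le_antiRank hZ fun y hy =>
      ⟨(hb y hy).1, (hb y hy).2.1, hD y hy (by rintro rfl; exact hxZ hy)⟩

/-- In the row of its antidiagonal, the last box acts like a Demazure operator. In an antidiagonal of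
the first `x.1 + x.2 + 1` rows, at most `x.2` boxes lie below row `x.1` or before column `x.2`. They
can be replaced by a segment of `x.2` boxes in the rows from `x.1` on, which avoids the last of these
rows, or by one of `x.2 + 1` boxes in the rows after `x.1`, which needs one row more. The second
choice is possible if the antidiagonal has a box in row `x.1` east of `x`, the first one if not. -/
lemma antiRank_diag {D : Finset (ℕ × ℕ)} {x : ℕ × ℕ} (hx : IsLast D x) (q : ℕ) :
    antiRank D (x.1 + x.2 + 1) q ≤
      max (antiRank (D.erase x) (x.1 + x.2) q) (antiRank (D.erase x) (x.1 + x.2 + 2) q - 1) := by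
  rw [← antiRank_erase_of_ne hx (by omega), ← antiRank_erase_of_ne hx (by omega)]
  refine antiRank_le fun Z hZ hb => ?_
  have hle := hZ.card_filter_southwest_le (a := x.1 + 1) (n := x.2)
    fun y hy => by have := hb y hy; omega
  have hq : (Z.filter fun y => x.1 + 1 ≤ y.1 ∨ y.2 < x.2).card ≤ q :=
    (Finset.card_filter_le _ _).trans
      (hZ.card_le_of_snd (a := 0) fun y hy => by have := hb y hy; omega)
  by_cases hrow : ∃ y ∈ Z, y.1 = x.1 ∧ x.2 < y.2
  · obtain ⟨y, hy, hy₁, hy₂⟩ := hrow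
    have key : Z.card + 1 ≤ antiRank D (x.1 + x.2 + 2) q := by
      refine hZ.card_add_le_antiRank (fun y => x.1 + 1 ≤ y.1 ∨ y.2 < x.2) (a := x.1 + 1)
        (n := x.2 + 1) (fun z hz _ => ?_) (fun z hz hPz => ?_) (fun z hz => ?_) (by omega)
      · have := hb z hz
        exact ⟨by omega, this.2⟩
      · by_cases hzy : z = y
        · subst hzy; omega
        · have := hZ z hz y hy hzy
          omega
      · rw [mem_segment] at hz
        have := hb y hy
        refine ⟨by omega, by omega, fun hzD => ?_⟩
        have := hx.2 z hzD
        omega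
    omega
  · push Not at hrow
    have key : Z.card + 0 ≤ antiRank D (x.1 + x.2) q := by
      -- all of `Z` is replaced when `q < x.2`
      refine hZ.card_add_le_antiRank (fun y => x.1 + 1 ≤ y.1 ∨ y.2 < x.2) (a := x.1)
        (n := min x.2 q) (fun z hz hPz => ?_) (fun z hz hPz => ?_) (fun z hz => ?_) (by omega)
      all_goals
        try have hzb := hb z hz
        try have hzr := hrow z hz
        try have hzx : z ≠ x := fun h => hzb.2.2 (h ▸ hx.1)
        try rw [Ne, Prod.ext_iff] at hzx
      · exact ⟨by omega, hzb.2⟩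
      · omega
      · rw [mem_segment] at hz
        refine ⟨by omega, by omega, fun hzD => ?_⟩
        have := hx.2 z hzD
        omega
    omega

/-- **Subword property.** The rank conditions of `σ` on the longest antidiagonals that avoid `D` can
only hold if `D` has `inv σ` boxes, and they can be met by exactly `inv σ` boxes of `D`. -/
lemma exists_subset_card_eq_inv (D : Finset (ℕ × ℕ)) {σ : Equiv.Perm ℕ} (hσ : IsFinitary σ)
    (h : ∀ p q, antiRank D p q ≤ rk σ p q) :
    ∃ E ⊆ D, (∀ p q, antiRank E p q ≤ rk σ p q) ∧ E.card = inv σ := by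
  induction hn : D.card generalizing D σ with
  | zero =>
    rw [Finset.card_eq_zero] at hn
    subst hn
    refine ⟨∅, le_rfl, h, ?_⟩
    have hfix : ∀ p i, i < p → σ i < p := by
      intro p
      have h₁ : p ≤ rk σ p p := (le_antiRank_empty p).trans (h p p)
      have h₂ : (Finset.range p).filter (fun i => σ i < p) = Finset.range p :=
        Finset.eq_of_subset_of_card_le (Finset.filter_subset _ _) (by simpa [rk] using h₁)
      intro i hi
      have := Finset.mem_range.2 hi
      rw [← h₂, Finset.mem_filter] at this
      exact this.2
    have hle : ∀ i, σ i ≤ i := fun i => Nat.lt_succ_iff.1 (hfix (i + 1) i (Nat.lt_succ_self i))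
    have hσ1 : ∀ i, σ i = i := by
      intro i
      induction i using Nat.strong_induction_on with
      | _ i ih =>
        by_contra hne
        exact hne (σ.injective (ih (σ i) (lt_of_le_of_ne (hle i) hne)))
    rw [show σ = 1 from Equiv.ext hσ1, inv_one, Finset.card_empty]
  | succ n ih =>
    obtain ⟨x, hx⟩ := exists_isLast (Finset.card_pos.1 (by omega : 0 < D.card))
    have hcard : (D.erase x).card = n := by rw [Finset.card_erase_of_mem hx.1]; omega
    set i := x.1 + x.2 with hi
    rcases lt_or_gt_of_ne (ne_apply_succ σ i) with hasc | hdesc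
    · -- at an ascent the last box is superfluous
      obtain ⟨E, hE, hE'⟩ := ih (D.erase x) hσ
        (le_rk_of_ascent hasc (isRankLike_antiRank _) fun p q hp => by
          rw [← antiRank_erase_of_ne hx hp]; exact h p q) hcard
      exact ⟨E, hE.trans (Finset.erase_subset _ _), hE'⟩
    · -- at a descent the other boxes serve `σ * swap i (i + 1)`, which has one inversion less
      obtain ⟨E, hE, hle, hinv⟩ := ih (D.erase x) (hσ.mul_swap i)
        (le_rk_of_ascent (i := i) (by simpa using hdesc) (isRankLike_antiRank _) fun p q hp => by
          rw [← antiRank_erase_of_ne hx hp, rk_mul_swap _ _ hp]; exact h p q) hcard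
      have hxE : x ∉ E := fun hxE => by simpa using hE hxE
      have hx' : IsLast (insert x E) x := by
        refine ⟨Finset.mem_insert_self _ _, fun y hy => ?_⟩
        rcases Finset.mem_insert.1 hy with rfl | hy
        · exact Or.inr ⟨rfl, le_rfl⟩
        · exact hx.2 y (Finset.erase_subset _ _ (hE hy))
      refine ⟨insert x E, Finset.insert_subset hx.1 (hE.trans (Finset.erase_subset _ _)), ?_, ?_⟩
      · intro p q
        by_cases hp : p = i + 1
        · have h₁ := antiRank_diag hx' q
          rw [Finset.erase_insert hxE, ← hi] at h₁
          have h₂ := hle i q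
          have h₃ := hle (i + 2) q
          rw [rk_mul_swap _ _ (by omega)] at h₂ h₃
          have h₄ := (isRankLike_rk σ).le_succ_left i q
          have h₅ := (isRankLike_rk σ).succ_left_le (i + 1) q
          rw [hp]
          simp only [add_assoc, Nat.reduceAdd] at *
          omega
        · rw [antiRank_erase_of_ne hx' hp, Finset.erase_insert hxE, ← rk_mul_swap σ i hp]
          exact hle p q
      · rw [Finset.card_insert_of_notMem hxE, hinv, inv_eq_of_descent hσ hdesc]

/-! ### Maximal rectangles of a moon polyomino -/

lemma mem_Icc_box {a b i j r c : ℕ} :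
    (r, c) ∈ Finset.Icc (a, b) (i, j) ↔ (a ≤ r ∧ r ≤ i) ∧ b ≤ c ∧ c ≤ j := by
  simp only [Finset.mem_Icc, Prod.mk_le_mk]
  tauto

section MaximalRectangle

variable {M : Finset (ℕ × ℕ)} {a b i j a' b' i' j' : ℕ}

lemma IsMaximalRectangle.mem (h : IsMaximalRectangle M a b i j) {r c : ℕ} (h₁ : a ≤ r) (h₂ : r ≤ i)
    (h₃ : b ≤ c) (h₄ : c ≤ j) : (r, c) ∈ M :=
  h.2.2.1 (mem_Icc_box.2 ⟨⟨h₁, h₂⟩, h₃, h₄⟩)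

/-- A maximal rectangle contains all rows of `M` that span its columns. -/
lemma IsMaximalRectangle.row_mem (h : IsMaximalRectangle M a b i j) (hM : IsConvex M) {r : ℕ}
    (hr : ∀ c, b ≤ c → c ≤ j → (r, c) ∈ M) : a ≤ r ∧ r ≤ i := by
  obtain ⟨hai, hbj, -, hmax⟩ := id h
  have h₁ := hmax (min a r) b (max i r) j (fun ⟨s, c⟩ hs => by
    rw [mem_Icc_box] at hs
    have hrc := hr c hs.2.1 hs.2.2
    have h₁ := h.mem le_rfl hai hs.2.1 hs.2.2
    have h₂ := h.mem hai le_rfl hs.2.1 hs.2.2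
    rcases le_total r s with hrs | hrs
    · rcases le_or_gt s i with hsi | hsi
      · exact hM.2 c r s i hrc h₂ hrs hsi
      · exact (show r = s by omega) ▸ hrc
    · rcases le_or_gt a s with has | has
      · exact hM.2 c a s r h₁ hrc has hrs
      · exact (show r = s by omega) ▸ hrc) (fun ⟨s, c⟩ hs => by
    rw [mem_Icc_box] at hs ⊢
    omega)
  have h₂ : (r, b) ∈ Finset.Icc (min a r, b) (max i r, j) := by
    rw [mem_Icc_box]
    omega
  rw [h₁, mem_Icc_box] at h₂
  exact h₂.1

/-- A maximal rectangle contains all columns of `M` that span its rows. -/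
lemma IsMaximalRectangle.col_mem (h : IsMaximalRectangle M a b i j) (hM : IsConvex M) {c : ℕ}
    (hc : ∀ r, a ≤ r → r ≤ i → (r, c) ∈ M) : b ≤ c ∧ c ≤ j := by
  obtain ⟨hai, hbj, -, hmax⟩ := id h
  have h₁ := hmax a (min b c) i (max j c) (fun ⟨r, s⟩ hs => by
    rw [mem_Icc_box] at hs
    have hrc := hc r hs.1.1 hs.1.2
    have h₁ := h.mem hs.1.1 hs.1.2 le_rfl hbj
    have h₂ := h.mem hs.1.1 hs.1.2 hbj le_rfl
    rcases le_total c s with hcs | hcs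
    · rcases le_or_gt s j with hsj | hsj
      · exact hM.1 r c s j hrc h₂ hcs hsj
      · exact (show c = s by omega) ▸ hrc
    · rcases le_or_gt b s with hbs | hbs
      · exact hM.1 r b s c h₁ hrc hbs hcs
      · exact (show c = s by omega) ▸ hrc) (fun ⟨r, s⟩ hs => by
    rw [mem_Icc_box] at hs ⊢
    omega)
  have h₂ : (a, c) ∈ Finset.Icc (a, min b c) (i, max j c) := by
    rw [mem_Icc_box]
    omega
  rw [h₁, mem_Icc_box] at h₂
  exact h₂.2

/-- The four corner regions of a maximal rectangle contain no boxes of `M`. -/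
lemma IsMaximalRectangle.notMem_corner (h : IsMaximalRectangle M a b i j) (hM : IsMoonPolyomino M)
    {r c : ℕ} (hr : ¬ (a ≤ r ∧ r ≤ i)) (hc : ¬ (b ≤ c ∧ c ≤ j)) : (r, c) ∉ M := by
  intro hrc
  obtain ⟨c', h₁, h₂, h₃⟩ : ∃ c', b ≤ c' ∧ c' ≤ j ∧ (r, c') ∉ M := by
    by_contra! hne
    exact hr (h.row_mem hM.1 hne)
  rcases hM.2 c c' with hcc | hcc
  · exact h₃ (hcc r hrc)
  · exact hc (h.col_mem hM.1 fun s hs₁ hs₂ => hcc s (h.mem hs₁ hs₂ h₁ h₂))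

/-- Two maximal rectangles cross each other: one has fewer rows and more columns. -/
lemma IsMaximalRectangle.nested (h : IsMaximalRectangle M a b i j)
    (h' : IsMaximalRectangle M a' b' i' j') (hM : IsMoonPolyomino M) :
    (a' ≤ a ∧ i ≤ i' ∧ b ≤ b' ∧ j' ≤ j) ∨ (a ≤ a' ∧ i' ≤ i ∧ b' ≤ b ∧ j ≤ j') := by
  -- once the rows are nested, so are the columns, the other way round
  have cols : ∀ {a b i j a' b' i' j' : ℕ}, IsMaximalRectangle M a b i j →
      IsMaximalRectangle M a' b' i' j' → a' ≤ a → i ≤ i' → b ≤ b' ∧ j' ≤ j := by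
    intro a b i j a' b' i' j' h h' h₁ h₂
    have hb := h'.2.1
    have h₃ := h.col_mem hM.1 (c := b') fun r hr hr' =>
      h'.mem (h₁.trans hr) (hr'.trans h₂) le_rfl hb
    have h₄ := h.col_mem hM.1 (c := j') fun r hr hr' =>
      h'.mem (h₁.trans hr) (hr'.trans h₂) hb le_rfl
    exact ⟨h₃.1, h₄.2⟩
  by_cases hrows : ∀ r, a ≤ r → r ≤ i → a' ≤ r ∧ r ≤ i'
  · have h₁ := (hrows a le_rfl h.1).1
    have h₂ := (hrows i h.1 le_rfl).2
    exact Or.inl ⟨h₁, h₂, cols h h' h₁ h₂⟩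
  · push Not at hrows
    obtain ⟨r, hr₁, hr₂, hr₃⟩ := hrows
    obtain ⟨c', h₁, h₂, h₃⟩ : ∃ c', b' ≤ c' ∧ c' ≤ j' ∧ (r, c') ∉ M := by
      by_contra! hne
      have := h'.row_mem hM.1 hne
      omega
    have hrows' : ∀ s, a' ≤ s → s ≤ i' → a ≤ s ∧ s ≤ i := fun s hs₁ hs₂ =>
      h.row_mem hM.1 fun c hc₁ hc₂ => by
        rcases hM.2 c c' with hcc | hcc
        · exact absurd (hcc r (h.mem hr₁ hr₂ hc₁ hc₂)) h₃
        · exact hcc s (h'.mem hs₁ hs₂ h₁ h₂)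
    have h₁ := (hrows' a' le_rfl h'.1).1
    have h₂ := (hrows' i' h'.1 le_rfl).2
    exact Or.inr ⟨h₁, h₂, cols h' h h₁ h₂⟩

/-- Every rectangle in `M` lies in a maximal one. -/
lemma exists_isMaximalRectangle (hai : a ≤ i) (hbj : b ≤ j)
    (h : Finset.Icc (a, b) (i, j) ⊆ M) :
    ∃ a' b' i' j', IsMaximalRectangle M a' b' i' j' ∧ a' ≤ a ∧ i ≤ i' ∧ b' ≤ b ∧ j ≤ j' := by
  have hfin : {T : Finset (ℕ × ℕ) | T ⊆ M ∧ ∃ x y, T = Finset.Icc x y}.Finite :=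
    M.powerset.finite_toSet.subset fun T hT => by simpa using hT.1
  obtain ⟨T, hle, ⟨hTM, ⟨a', b'⟩, ⟨i', j'⟩, rfl⟩, hmax⟩ :=
    hfin.exists_le_maximal (a := Finset.Icc (a, b) (i, j)) ⟨h, _, _, rfl⟩
  have h₁ := hle (mem_Icc_box.2 ⟨⟨le_rfl, hai⟩, le_rfl, hbj⟩)
  have h₂ := hle (mem_Icc_box.2 ⟨⟨hai, le_rfl⟩, hbj, le_rfl⟩)
  rw [mem_Icc_box] at h₁ h₂
  refine ⟨a', b', i', j', ⟨by omega, by omega, hTM, fun a₁ b₁ i₁ j₁ hM hsub => ?_⟩, by omega,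
    by omega, by omega, by omega⟩
  exact le_antisymm (hmax ⟨hM, _, _, rfl⟩ hsub) hsub

end MaximalRectangle

/-! ### Existence of the permutation -/

/-- The corner boxes `((a, b), (i, j))` of a maximal rectangle of height and width larger than
`k`. -/
def IsBig (k : ℕ) (M : Finset (ℕ × ℕ)) (x : (ℕ × ℕ) × ℕ × ℕ) : Prop :=
  IsMaximalRectangle M x.1.1 x.1.2 x.2.1 x.2.2 ∧ k < x.2.1 + 1 - x.1.1 ∧ k < x.2.2 + 1 - x.1.2

open Classical in
/-- The finite set of all maximal rectangles with the property `IsBig k M`. -/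
noncomputable def bigRectangles (k : ℕ) (M : Finset (ℕ × ℕ)) : Finset ((ℕ × ℕ) × ℕ × ℕ) :=
  (M ×ˢ M).filter (IsBig k M)

lemma mem_bigRectangles {k : ℕ} {M : Finset (ℕ × ℕ)} {x : (ℕ × ℕ) × ℕ × ℕ} :
    x ∈ bigRectangles k M ↔ IsBig k M x := by
  classical
  rw [bigRectangles, Finset.mem_filter, Finset.mem_product, and_iff_right_iff_imp]
  intro h
  exact ⟨h.1.mem le_rfl h.1.1 le_rfl h.1.2.1, h.1.mem h.1.1 le_rfl h.1.2.1 le_rfl⟩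

/-- The bound on a rank-like function at `(p, q)` that follows from the condition in the marked box
of the rectangle `x`. -/
def markedBound (k : ℕ) (x : (ℕ × ℕ) × ℕ × ℕ) (p q : ℕ) : ℕ :=
  x.1.1 + x.1.2 + k + (p - (x.2.1 + 1 + x.1.2)) + (q - (x.2.2 + 1 + x.1.1))

/-- The largest rank-like function that satisfies the conditions in all marked boxes. -/
noncomputable def sigmaRank (k : ℕ) (M : Finset (ℕ × ℕ)) (p q : ℕ) : ℕ :=
  (bigRectangles k M).fold min (min p q) fun x => markedBound k x p q

section sigmaRank

variable {k : ℕ} {M : Finset (ℕ × ℕ)}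

lemma le_sigmaRank {n p q : ℕ} :
    n ≤ sigmaRank k M p q ↔ n ≤ p ∧ n ≤ q ∧ ∀ x, IsBig k M x → n ≤ markedBound k x p q := by
  rw [sigmaRank, Finset.le_fold_min, le_min_iff, and_assoc]
  simp only [mem_bigRectangles]

lemma sigmaRank_le (p q : ℕ) : sigmaRank k M p q ≤ p ∧ sigmaRank k M p q ≤ q ∧
    ∀ x, IsBig k M x → sigmaRank k M p q ≤ markedBound k x p q :=
  le_sigmaRank.1 le_rfl

lemma sigmaRank_eq (p q : ℕ) : sigmaRank k M p q = p ∨ sigmaRank k M p q = q ∨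
    ∃ x, IsBig k M x ∧ sigmaRank k M p q = markedBound k x p q := by
  have h : sigmaRank k M p q ≤ sigmaRank k M p q := le_rfl
  have hle := sigmaRank_le (k := k) (M := M) p q
  rw [sigmaRank, Finset.fold_min_le, ← sigmaRank, min_le_iff] at h
  rcases h with (h | h) | ⟨x, hx, h⟩
  · exact Or.inl (by omega)
  · exact Or.inr (Or.inl (by omega))
  · rw [mem_bigRectangles] at hx
    exact Or.inr (Or.inr ⟨x, hx, le_antisymm (hle.2.2 x hx) h⟩)

lemma isRankLike_sigmaRank (k : ℕ) (M : Finset (ℕ × ℕ)) : IsRankLike (sigmaRank k M) where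
  zero_left q := Nat.le_zero.1 (sigmaRank_le 0 q).1
  zero_right p := Nat.le_zero.1 (sigmaRank_le p 0).2.1
  le_succ_left p q := by
    obtain ⟨h₁, h₂, h₃⟩ := sigmaRank_le (k := k) (M := M) p q
    refine le_sigmaRank.2 ⟨by omega, h₂, fun x hx => (h₃ x hx).trans ?_⟩
    simp only [markedBound]
    omega
  le_succ_right p q := by
    obtain ⟨h₁, h₂, h₃⟩ := sigmaRank_le (k := k) (M := M) p q
    refine le_sigmaRank.2 ⟨h₁, by omega, fun x hx => (h₃ x hx).trans ?_⟩
    simp only [markedBound]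
    omega
  succ_left_le p q := by
    obtain ⟨h₁, h₂, h₃⟩ := sigmaRank_le (k := k) (M := M) (p + 1) q
    rcases sigmaRank_eq (k := k) (M := M) p q with h | h | ⟨x, hx, h⟩
    · omega
    · omega
    · have := h₃ x hx
      simp only [markedBound] at this h
      omega
  succ_right_le p q := by
    obtain ⟨h₁, h₂, h₃⟩ := sigmaRank_le (k := k) (M := M) p (q + 1)
    rcases sigmaRank_eq (k := k) (M := M) p q with h | h | ⟨x, hx, h⟩
    · omega
    · omega
    · have := h₃ x hx
      simp only [markedBound] at this h
      omega

/-- The bounds are sums of a function of `p` and one of `q`, and the marked boxes lie on a path from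
north-east to south-west; hence their minimum is supermodular. -/
lemma sigmaRank_supermodular (hM : IsMoonPolyomino M) (p q : ℕ) :
    sigmaRank k M p (q + 1) + sigmaRank k M (p + 1) q ≤
      sigmaRank k M (p + 1) (q + 1) + sigmaRank k M p q := by
  obtain ⟨a₁, a₂, a₃⟩ := sigmaRank_le (k := k) (M := M) p (q + 1)
  obtain ⟨b₁, b₂, b₃⟩ := sigmaRank_le (k := k) (M := M) (p + 1) q
  rcases sigmaRank_eq (k := k) (M := M) p q with h | h | ⟨x, hx, h⟩ <;>
    rcases sigmaRank_eq (k := k) (M := M) (p + 1) (q + 1) with h' | h' | ⟨y, hy, h'⟩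
  · omega
  · omega
  · have := b₃ y hy
    simp only [markedBound] at *
    omega
  · omega
  · omega
  · have := a₃ y hy
    simp only [markedBound] at *
    omega
  · have := a₃ x hx
    have := b₃ x hx
    simp only [markedBound] at *
    omega
  · have := a₃ x hx
    have := b₃ x hx
    simp only [markedBound] at *
    omega
  · have h₁ := a₃ x hx
    have h₂ := b₃ x hx
    have h₃ := a₃ y hy
    have h₄ := b₃ y hy
    have h₅ := hx.1.nested hy.1 hM
    simp only [markedBound] at *
    rcases h₅ with h₅ | h₅ <;> omega

lemma exists_sigmaRank_eq_min (k : ℕ) (M : Finset (ℕ × ℕ)) :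
    ∃ N, ∀ p q, N ≤ p ∨ N ≤ q → sigmaRank k M p q = min p q := by
  refine ⟨(bigRectangles k M).sup fun x => x.2.1 + 1 + x.1.2 + (x.2.2 + 1 + x.1.1),
    fun p q hpq => ?_⟩
  refine le_antisymm (le_min (sigmaRank_le p q).1 (sigmaRank_le p q).2.1) ?_
  refine le_sigmaRank.2 ⟨min_le_left _ _, min_le_right _ _, fun x hx => ?_⟩
  have := Finset.le_sup (f := fun x : (ℕ × ℕ) × ℕ × ℕ => x.2.1 + 1 + x.1.2 + (x.2.2 + 1 + x.1.1))
    (mem_bigRectangles.2 hx)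
  simp only [markedBound] at *
  omega

/-- Two different maximal rectangles have different rows and different columns, so that the bound
of one is not attained at the marked box of the other. -/
lemma IsBig.lt_markedBound {x y : (ℕ × ℕ) × ℕ × ℕ} (hx : IsBig k M x) (hy : IsBig k M y)
    (hM : IsMoonPolyomino M) (hne : x ≠ y) :
    x.1.1 + x.1.2 + k < markedBound k y (x.2.1 + 1 + x.1.2) (x.2.2 + 1 + x.1.1) := by
  obtain ⟨⟨a, b⟩, ⟨i, j⟩⟩ := x
  obtain ⟨⟨a', b'⟩, ⟨i', j'⟩⟩ := y
  have h₁ := hx.1.2.1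
  have h₂ := hy.1.2.1
  have h₃ := hx.1.1
  have h₄ := hy.1.1
  have hrows : ¬ (a = a' ∧ i = i' ∧ ¬ (b = b' ∧ j = j')) := by
    rintro ⟨rfl, rfl, h⟩
    have h₁ := hx.1.col_mem hM.1 fun r hr hr' => hy.1.mem hr hr' le_rfl h₂
    have h₂ := hx.1.col_mem hM.1 fun r hr hr' => hy.1.mem hr hr' h₂ le_rfl
    have h₃ := hy.1.col_mem hM.1 fun r hr hr' => hx.1.mem hr hr' le_rfl hx.1.2.1
    have h₄ := hy.1.col_mem hM.1 fun r hr hr' => hx.1.mem hr hr' hx.1.2.1 le_rfl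
    simp only at *
    omega
  have hcols : ¬ (b = b' ∧ j = j' ∧ ¬ (a = a' ∧ i = i')) := by
    rintro ⟨rfl, rfl, h⟩
    have h₁ := hx.1.row_mem hM.1 fun c hc hc' => hy.1.mem le_rfl h₄ hc hc'
    have h₂ := hx.1.row_mem hM.1 fun c hc hc' => hy.1.mem h₄ le_rfl hc hc'
    have h₃ := hy.1.row_mem hM.1 fun c hc hc' => hx.1.mem le_rfl hx.1.1 hc hc'
    have h₄ := hy.1.row_mem hM.1 fun c hc hc' => hx.1.mem hx.1.1 le_rfl hc hc'
    simp only at *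
    omega
  have hnest := hx.1.nested hy.1 hM
  simp only [ne_eq, Prod.mk.injEq, markedBound] at *
  omega

/-- The marked boxes are exactly the essential boxes of the permutation with rank function
`sigmaRank k M`. -/
lemma existsUnique_isSigma (hM : IsMoonPolyomino M) : ∃! σ : Equiv.Perm ℕ, IsSigma k M σ := by
  obtain ⟨N, hN⟩ := exists_sigmaRank_eq_min k M
  obtain ⟨σ, hσ, hrk⟩ := exists_perm_rk_eq (isRankLike_sigmaRank k M) (sigmaRank_supermodular hM)
    N hN
  suffices h : essentialSet σ = markedBoxes k M from
    ⟨σ, ⟨hσ, h⟩, fun τ hτ => eq_of_essentialSet_eq hτ.1 hσ (hτ.2.trans h.symm)⟩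
  ext ⟨⟨p, q⟩, l⟩
  simp only [mem_essentialSet, hrk, markedBoxes, Set.mem_ofPred_eq, Prod.mk.injEq]
  constructor
  · rintro ⟨p, q, ⟨⟨rfl, rfl⟩, rfl⟩, h₁, h₂, h₃, h₄⟩
    rcases sigmaRank_eq (k := k) (M := M) (p + 1) (q + 1) with h | h | ⟨x, hx, h⟩
    · have := (sigmaRank_le (k := k) (M := M) p (q + 1)).1
      omega
    · have := (sigmaRank_le (k := k) (M := M) (p + 1) q).2.1
      omega
    · have k₁ := (sigmaRank_le (k := k) (M := M) p (q + 1)).2.2 x hx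
      have k₂ := (sigmaRank_le (k := k) (M := M) (p + 1) q).2.2 x hx
      have k₃ := (sigmaRank_le (k := k) (M := M) (p + 2) (q + 1)).2.2 x hx
      have k₄ := (sigmaRank_le (k := k) (M := M) (p + 1) (q + 2)).2.2 x hx
      refine ⟨x.1.1, x.1.2, x.2.1, x.2.2, hx.1, hx.2.1, hx.2.2, ?_⟩
      simp only [markedBound] at *
      omega
  · rintro ⟨a, b, i, j, hmax, hi, hj, ⟨rfl, rfl⟩, rfl⟩
    have hx : IsBig k M ((a, b), (i, j)) := ⟨hmax, hi, hj⟩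
    have key : ∀ y, IsBig k M y → y = ((a, b), (i, j)) ∨
        a + b + k < markedBound k y (i + 1 + b) (j + 1 + a) := by
      intro y hy
      by_cases hne : ((a, b), (i, j)) = y
      · exact Or.inl hne.symm
      · exact Or.inr (hx.lt_markedBound hy hM hne)
    have c : sigmaRank k M (i + b + 1) (j + a + 1) = a + b + k := by
      refine le_antisymm (((sigmaRank_le _ _).2.2 _ hx).trans ?_) (le_sigmaRank.2 ⟨by omega,
        by omega, fun y hy => ?_⟩)
      · simp only [markedBound]; omega
      · rcases key y hy with rfl | h <;> simp only [markedBound] at * <;> omega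
    refine ⟨i + b, j + a, ⟨⟨rfl, rfl⟩, c.symm⟩, ?_⟩
    rw [c]
    refine ⟨le_antisymm (c ▸ (isRankLike_sigmaRank k M).le_succ_left _ _) ?_,
      le_antisymm (c ▸ (isRankLike_sigmaRank k M).le_succ_right _ _) ?_,
      le_antisymm (c ▸ (isRankLike_sigmaRank k M).succ_left_le _ _) ?_,
      le_antisymm (c ▸ (isRankLike_sigmaRank k M).succ_right_le _ _) ?_⟩ <;>
    refine le_sigmaRank.2 ⟨by omega, by omega, fun y hy => ?_⟩ <;>
    rcases key y hy with rfl | h <;> simp only [markedBound] at * <;> omega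

end sigmaRank

/-! ### Chains and rank conditions -/

variable {k : ℕ} {M F : Finset (ℕ × ℕ)}

lemma exists_chain_of_isAntidiag {Z : Finset (ℕ × ℕ)} (hZ : IsAntidiag Z) {n : ℕ}
    (hn : n ≤ Z.card) : ∃ c : Fin n → ℕ × ℕ, (∀ x, c x ∈ Z) ∧
      ∀ x y, x < y → (c y).1 < (c x).1 ∧ (c x).2 < (c y).2 := by
  obtain ⟨Y, hYZ, hY⟩ := Finset.exists_subset_card_eq hn
  have hcard : (Y.image Prod.snd).card = n := by
    rw [Finset.card_image_of_injOn (hZ.subset hYZ).snd_injOn, hY]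
  have hex : ∀ x, ∃ z ∈ Y, z.2 = (Y.image Prod.snd).orderEmbOfFin hcard x := fun x =>
    Finset.mem_image.1 (Finset.orderEmbOfFin_mem _ hcard x)
  choose c hc hc' using hex
  refine ⟨c, fun x => hYZ (hc x), fun x y hxy => ?_⟩
  have hlt : (c x).2 < (c y).2 := by
    rw [hc', hc']
    exact ((Y.image Prod.snd).orderEmbOfFin hcard).strictMono hxy
  have := hZ (c x) (hYZ (hc x)) (c y) (hYZ (hc y)) (fun h => by rw [h] at hlt; omega)
  omega

/-- Absence of long chains in a big maximal rectangle is the rank condition in its marked box.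
Since `M` has no boxes in the corner regions of the rectangle, a chain in the rectangle extends by
antidiagonals in the south-west and in the north-east corner region; conversely, an antidiagonal has
no more boxes outside of the rectangle than these two. -/
lemma isNEFree_iff (hM : IsMoonPolyomino M) (hF : F ⊆ M) :
    IsNEFree k M F ↔ ∀ x, IsBig k M x →
      antiRank (M \ F) (x.2.1 + 1 + x.1.2) (x.2.2 + 1 + x.1.1) ≤ x.1.1 + x.1.2 + k := by
  constructor
  · rintro ⟨-, hfree⟩ ⟨⟨a, b⟩, i, j⟩ hx
    simp only
    have hmax : IsMaximalRectangle M a b i j := hx.1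
    refine antiRank_le fun Z hZ hb => ?_
    have h₁ := hZ.card_filter_southwest_le (a := i + 1) (n := b) fun x hx => (hb x hx).1
    have h₂ := hZ.card_filter_northeast_le (a := j + 1) (n := a) fun x hx => (hb x hx).2.1
    set Y := Z.filter fun x => (a ≤ x.1 ∧ x.1 ≤ i) ∧ b ≤ x.2 ∧ x.2 ≤ j with hYdef
    have hY : Y.card ≤ k := by
      by_contra hlt
      obtain ⟨c, hc, hlt⟩ := exists_chain_of_isAntidiag (hZ.subset (Finset.filter_subset _ _))
        (show k + 1 ≤ Y.card by omega)
      simp only [Finset.mem_filter] at hc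
      refine hfree ⟨c, ⟨fun x => hmax.mem (hc x).2.1.1 (hc x).2.1.2 (hc x).2.2.1 (hc x).2.2.2, hlt,
        fun p hp => ?_⟩, fun x => ?_⟩
      · obtain ⟨⟨⟨x₁, h₁⟩, x₂, h₂⟩, ⟨x₃, h₃⟩, x₄, h₄⟩ := hp
        exact hmax.mem ((hc x₁).2.1.1.trans h₁) (h₂.trans (hc x₂).2.1.2)
          ((hc x₃).2.2.1.trans h₃) (h₄.trans (hc x₄).2.2.2)
      · by_contra hxF
        exact (hb _ (hc x).1).2.2 (Finset.mem_sdiff.2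
          ⟨hmax.mem (hc x).2.1.1 (hc x).2.1.2 (hc x).2.2.1 (hc x).2.2.2, hxF⟩)
    have hcover : Z ⊆ Y ∪ ((Z.filter fun x => i + 1 ≤ x.1 ∨ x.2 < b) ∪
        Z.filter fun x => j + 1 ≤ x.2 ∨ x.1 < a) := by
      intro x hx
      simp only [hYdef, Finset.mem_union, Finset.mem_filter, hx, true_and]
      omega
    have h₃ := (Finset.card_le_card hcover).trans (Finset.card_union_le _ _)
    have h₄ := Finset.card_union_le (Z.filter fun x => i + 1 ≤ x.1 ∨ x.2 < b)
      (Z.filter fun x => j + 1 ≤ x.2 ∨ x.1 < a)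
    omega
  · intro h
    refine ⟨hF, ?_⟩
    rintro ⟨c, ⟨hcM, hlt, hrect⟩, hcF⟩
    have hanti : ∀ x, (c (Fin.last k)).1 ≤ (c x).1 ∧ (c x).1 ≤ (c 0).1 ∧
        (c 0).2 ≤ (c x).2 ∧ (c x).2 ≤ (c (Fin.last k)).2 := by
      intro x
      have h₁ : (c (Fin.last k)).1 ≤ (c x).1 ∧ (c x).2 ≤ (c (Fin.last k)).2 := by
        rcases (Fin.le_last x).eq_or_lt with rfl | hx
        · exact ⟨le_rfl, le_rfl⟩
        · exact ⟨(hlt _ _ hx).1.le, (hlt _ _ hx).2.le⟩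
      have h₂ : (c x).1 ≤ (c 0).1 ∧ (c 0).2 ≤ (c x).2 := by
        rcases (Fin.zero_le x).eq_or_lt with rfl | hx
        · exact ⟨le_rfl, le_rfl⟩
        · exact ⟨(hlt _ _ hx).1.le, (hlt _ _ hx).2.le⟩
      exact ⟨h₁.1, h₂.1, h₂.2, h₁.2⟩
    have hlast := hanti (Fin.last k)
    obtain ⟨a, b, i, j, hmax, ha, hi, hb, hj⟩ := exists_isMaximalRectangle (M := M)
      hlast.2.1 hlast.2.2.1 (fun ⟨r, s⟩ hp => hrect (by
        rw [mem_Icc_box] at hp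
        exact ⟨⟨⟨_, hp.1.1⟩, _, hp.1.2⟩, ⟨_, hp.2.1⟩, _, hp.2.2⟩))
    have hinj : Function.Injective c := by
      intro x y hxy
      by_contra hne
      rcases lt_or_gt_of_ne hne with h | h
      all_goals
        have := hlt _ _ h
        rw [hxy] at this
        omega
    set Z := Finset.univ.image c with hZdef
    have hZ : IsAntidiag Z := by
      intro x hx y hy hne
      obtain ⟨x, -, rfl⟩ := Finset.mem_image.1 hx
      obtain ⟨y, -, rfl⟩ := Finset.mem_image.1 hy
      rcases lt_trichotomy x y with hxy | rfl | hxy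
      · exact Or.inr (hlt _ _ hxy)
      · exact absurd rfl hne
      · exact Or.inl (hlt _ _ hxy)
    have hZcard : Z.card = k + 1 := by
      rw [hZdef, Finset.card_image_of_injective _ hinj, Finset.card_univ, Fintype.card_fin]
    have hZb : ∀ x ∈ Z, (a ≤ x.1 ∧ x.1 ≤ i) ∧ (b ≤ x.2 ∧ x.2 ≤ j) ∧ x ∈ F := by
      intro x hx
      obtain ⟨x, -, rfl⟩ := Finset.mem_image.1 hx
      have := hanti x
      exact ⟨by omega, by omega, hcF x⟩
    have hrows := hZ.card_le_of_fst (a := a) (n := i + 1 - a) fun x hx => by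
      have := hZb x hx
      omega
    have hcols := hZ.card_le_of_snd (a := b) (n := j + 1 - b) fun x hx => by
      have := hZb x hx
      omega
    have hlabel := h ((a, b), (i, j)) ⟨hmax, by simp only; omega, by simp only; omega⟩
    obtain ⟨hA, hAcard⟩ := (isAntidiag_segment (i + 1) 0 b).union hZ fun x hx y hy => by
      rw [mem_segment] at hx
      have := hZb y hy
      omega
    obtain ⟨hB, hBcard⟩ := hA.union (isAntidiag_segment 0 (j + 1) a) fun x hx y hy => by
      rw [mem_segment] at hy
      rcases Finset.mem_union.1 hx with hx | hx
      · rw [mem_segment] at hx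
        have := hmax.2.1
        omega
      · have := hZb x hx
        omega
    have hle := le_antiRank (D := M \ F) (p := i + 1 + b) (q := j + 1 + a) hB fun x hx => by
      have hai := hmax.1
      have hbj := hmax.2.1
      rw [Finset.mem_union, Finset.mem_union, mem_segment, mem_segment] at hx
      rw [Finset.mem_sdiff]
      rcases hx with (hx | hx) | hx
      · exact ⟨by omega, by omega, fun hxM =>
          hmax.notMem_corner hM (r := x.1) (c := x.2) (by omega) (by omega) hxM.1⟩
      · have := hZb x hx
        exact ⟨by omega, by omega, fun hxM => hxM.2 this.2.2⟩
      · exact ⟨by omega, by omega, fun hxM =>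
          hmax.notMem_corner hM (r := x.1) (c := x.2) (by omega) (by omega) hxM.1⟩
    rw [hBcard, hAcard, card_segment, card_segment, hZcard] at hle
    simp only at hlabel
    omega

lemma isNEFree_iff_le_rk (hM : IsMoonPolyomino M) (hF : F ⊆ M) {σ : Equiv.Perm ℕ}
    (hσ : IsSigma k M σ) : IsNEFree k M F ↔ ∀ p q, antiRank (M \ F) p q ≤ rk σ p q := by
  rw [isNEFree_iff hM hF]
  constructor
  · refine fun h => le_rk_of_le_essentialSet hσ.1 (isRankLike_antiRank _) fun p q l hl => ?_
    rw [hσ.2] at hl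
    obtain ⟨a, b, i, j, hmax, hi, hj, he⟩ := hl
    simp only [Prod.mk.injEq] at he
    obtain ⟨⟨rfl, rfl⟩, rfl⟩ := he
    have := h ((a, b), (i, j)) ⟨hmax, hi, hj⟩
    rwa [add_right_comm i, add_right_comm j]
  · rintro h ⟨⟨a, b⟩, i, j⟩ hx
    have hl : ((i + b, j + a), a + b + k) ∈ essentialSet σ := by
      rw [hσ.2]
      exact ⟨a, b, i, j, hx.1, hx.2.1, hx.2.2, rfl⟩
    obtain ⟨p, q, -, -, -, he⟩ := hl
    simp only [Prod.mk.injEq, rankFun_eq_rk] at he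
    obtain ⟨⟨rfl, rfl⟩, he⟩ := he
    rw [he, ← add_right_comm i, ← add_right_comm j]
    exact h _ _

/-! ### Maximal fillings -/

lemma IsNEFree.exists_superset (hM : IsMoonPolyomino M) {σ : Equiv.Perm ℕ} (hσ : IsSigma k M σ)
    (hF : IsNEFree k M F) : ∃ G, F ⊆ G ∧ IsNEFree k M G ∧ G.card + inv σ = M.card := by
  obtain ⟨E, hE, hle, hcard⟩ :=
    exists_subset_card_eq_inv (M \ F) hσ.1 ((isNEFree_iff_le_rk hM hF.1 hσ).1 hF)
  have hEM : E ⊆ M := hE.trans Finset.sdiff_subset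
  refine ⟨M \ E, fun x hx => Finset.mem_sdiff.2 ⟨hF.1 hx, fun hxE => ?_⟩, ?_, ?_⟩
  · exact (Finset.mem_sdiff.1 (hE hxE)).2 hx
  · rw [isNEFree_iff_le_rk hM Finset.sdiff_subset hσ, Finset.sdiff_sdiff_eq_self hEM]
    exact hle
  · rw [← hcard, Finset.card_sdiff_add_card_eq_card hEM]

lemma card_of_maximal (hM : IsMoonPolyomino M) {σ : Equiv.Perm ℕ} (hσ : IsSigma k M σ)
    (hF : Maximal (IsNEFree k M) F) : F.card + inv σ = M.card := by
  obtain ⟨G, hFG, hG, hcard⟩ := hF.prop.exists_superset hM hσ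
  rwa [hFG.antisymm (hF.2 hG hFG)]

lemma isNEFilling_of_maximal (hM : IsMoonPolyomino M) (hF : Maximal (IsNEFree k M) F) :
    IsNEFilling k M F := by
  obtain ⟨σ, hσ, -⟩ := existsUnique_isSigma (k := k) hM
  refine ⟨hF.prop, fun G hG => ?_⟩
  obtain ⟨G', hGG', -, hcard⟩ := hG.exists_superset hM hσ
  have h₁ := Finset.card_le_card hGG'
  have h₂ := card_of_maximal hM hσ hF
  omega

lemma IsNEFilling.maximal (hF : IsNEFilling k M F) : Maximal (IsNEFree k M) F :=
  ⟨hF.1, fun G hG hFG => (Finset.eq_of_subset_of_card_le hFG (hF.2 G hG)).ge⟩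

/-! ### Ferrers shapes -/

/-- In a Ferrers shape, the boxes in the first `k` rows together with the last `k` boxes of each row
form a maximal filling: a chain of length `k + 1` spans more than `k` columns of the row of its
first box, while any other box is the first one of a chain that continues in the first `k` rows. -/
lemma IsFerrersShape.maximal_filter (hM : IsFerrersShape M) :
    Maximal (IsNEFree k M) (M.filter fun x => x.1 < k ∨ (x.1, x.2 + k) ∉ M) := by
  have lower : ∀ {r c r' c' : ℕ}, (r, c) ∈ M → r' ≤ r → c' ≤ c → (r', c') ∈ M :=
    fun {r c r' c'} h hr hc => hM (show ((r', c') : ℕ × ℕ) ≤ (r, c) from ⟨hr, hc⟩) h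
  constructor
  · refine ⟨Finset.filter_subset _ _, ?_⟩
    rintro ⟨c, ⟨hcM, hlt, hrect⟩, hcF⟩
    have hsucc : ∀ m (hm : m < k + 1), (c ⟨m, hm⟩).1 + m ≤ (c 0).1 ∧
        (c 0).2 + m ≤ (c ⟨m, hm⟩).2 := by
      intro m
      induction m with
      | zero => exact fun _ => ⟨le_rfl, le_rfl⟩
      | succ m ih =>
        intro hm
        have h₁ := ih (by omega)
        have h₂ := hlt ⟨m, by omega⟩ ⟨m + 1, hm⟩ (by simp)
        omega
    have h₁ := hsucc k (Nat.lt_succ_self k)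
    have h₂ : ((c 0).1, (c ⟨k, Nat.lt_succ_self k⟩).2) ∈ M :=
      hrect ⟨⟨⟨0, le_rfl⟩, 0, le_rfl⟩, ⟨_, le_rfl⟩, _, le_rfl⟩
    rcases (Finset.mem_filter.1 (hcF 0)).2 with h₃ | h₃
    · omega
    · exact h₃ (lower h₂ le_rfl h₁.2)
  · intro G hG hFG x hx
    by_contra hxF
    have hxM := hG.1 hx
    rw [Finset.mem_filter] at hxF
    push Not at hxF
    obtain ⟨hk, hxk⟩ := hxF hxM
    refine hG.2 ⟨fun m => if m = 0 then x else (k - m, x.2 + m), ⟨fun m => ?_, fun m n hmn => ?_,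
      fun p hp => ?_⟩, fun m => ?_⟩
    · dsimp only
      split_ifs
      · exact hxM
      · exact lower hxk (by omega) (by omega)
    · have : n ≠ 0 := by rintro rfl; exact absurd hmn (Fin.not_lt_zero m)
      rw [Fin.lt_def] at hmn
      dsimp only
      rw [if_neg this]
      split_ifs with h
      · subst h
        simp only [Fin.val_zero] at *
        omega
      · simp only
        omega
    · obtain ⟨⟨-, y, hy⟩, -, z, hz⟩ := hp
      refine lower (r := x.1) (c := x.2 + k) (r' := p.1) (c' := p.2) hxk ?_ ?_
      · refine hy.trans ?_
        dsimp only
        split_ifs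
        · exact le_rfl
        · simp only; omega
      · refine hz.trans ?_
        dsimp only
        split_ifs
        · exact Nat.le_add_right _ _
        · simp only; omega
    · dsimp only
      split_ifs with h
      · exact hx
      · have h := Fin.val_ne_zero_iff.2 h
        exact hFG (Finset.mem_filter.2
          ⟨lower hxk (by omega) (by omega), Or.inl (by simp only; omega)⟩)

/-- Shifting by `k` columns takes the boxes outside of the maximal filling to the boxes outside of
the first `k` rows and columns. -/
lemma IsFerrersShape.card_filter (hM : IsFerrersShape M) :
    (M.filter fun x => x.1 < k ∨ (x.1, x.2 + k) ∉ M).card =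
      (M.filter fun x => x.1 < k ∨ x.2 < k).card := by
  have h₁ := Finset.card_filter_add_card_filter_not (s := M) fun x => x.1 < k ∨ (x.1, x.2 + k) ∉ M
  have h₂ := Finset.card_filter_add_card_filter_not (s := M) fun x => x.1 < k ∨ x.2 < k
  have h₃ : (M.filter fun x => ¬ (x.1 < k ∨ (x.1, x.2 + k) ∉ M)).card =
      (M.filter fun x => ¬ (x.1 < k ∨ x.2 < k)).card := by
    refine Finset.card_bij (fun x _ => (x.1, x.2 + k)) (fun x hx => ?_) (fun x _ y _ h => ?_)
      (fun x hx => ?_)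
    · simp only [Finset.mem_filter, not_or, not_not] at hx ⊢
      exact ⟨hx.2.2, hx.2.1, by omega⟩
    · simp only [Prod.mk.injEq] at h
      exact Prod.ext h.1 (by omega)
    · simp only [Finset.mem_filter, not_or, not_not, not_lt] at hx ⊢
      have he : (x.1, x.2 - k + k) = x := Prod.ext rfl (by simp only; omega)
      exact ⟨(x.1, x.2 - k), ⟨hM (show (x.1, x.2 - k) ≤ x from ⟨le_rfl, Nat.sub_le _ _⟩) hx.1,
        hx.2.1, by rw [he]; exact hx.1⟩, he⟩
  omega

end MoonFilling

theorem mainTheorem12 (M : Finset (ℕ × ℕ)) (hM : MoonFilling.IsMoonPolyomino M)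
    (k : ℕ) (hk : 0 < k) :
    -- the permutation `σ_k(M)` is well defined
    (∃! σ : Equiv.Perm ℕ, MoonFilling.IsSigma k M σ) ∧
    -- every filling that is inclusion-maximal without chains of length `k + 1` is
    -- a `k`-north-east filling
    (∀ F : Finset (ℕ × ℕ), Maximal (MoonFilling.IsNEFree k M) F → MoonFilling.IsNEFilling k M F) ∧
    -- every `k`-north-east filling has `|M| - ℓ(σ_k(M))` boxes
    (∀ σ : Equiv.Perm ℕ, MoonFilling.IsSigma k M σ →
      ∀ F : Finset (ℕ × ℕ), MoonFilling.IsNEFilling k M F →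
        F.card + MoonFilling.length σ = M.card) ∧
    -- for Ferrers shapes this is the number of boxes in the first `k` rows and columns
    (MoonFilling.IsFerrersShape M →
      ∀ F : Finset (ℕ × ℕ), MoonFilling.IsNEFilling k M F →
        F.card = (M.filter (fun x => x.1 < k ∨ x.2 < k)).card) := by

  obtain ⟨τ, hτ, hunique⟩ := MoonFilling.existsUnique_isSigma (k := k) hM
  refine ⟨⟨τ, hτ, hunique⟩, fun F hF => MoonFilling.isNEFilling_of_maximal hM hF,
    fun σ hσ F hF => ?_, fun hS F hF => ?_⟩
  · rw [MoonFilling.length_eq_inv hσ.1]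
    exact MoonFilling.card_of_maximal hM hσ hF.maximal
  · rw [← hS.card_filter]
    have h₁ := MoonFilling.card_of_maximal hM hτ hF.maximal
    have h₂ := MoonFilling.card_of_maximal hM hτ (hS.maximal_filter (k := k))
    omega
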